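/- Let $a\in(-1,0)$ and let $m\in C^1(\mathbb R)$ be a strictly positive probability density, $\nu(dx)=m(x)\,dx$. Let $\Omega=C(\mathbb R;\mathbb R)$ carry the Borel $\sigma$-algebra of locally uniform convergence, and let $Q$ be the law on $\Omega$ of two-sided Brownian motion $W$ with initial distribution $\nu$: $W_0\sim\nu$ is independent of $(W_s-W_0)_{s\in\mathbb R}$, and $(W_s-W_0)_{s\ge0}$, $(W_{-s}-W_0)_{s\ge0}$ are independent standard Brownian motions. *The process with delay.* For $k\in\mathbb Z_+$ and $v_0\in[-1,0]$ put $$p_k(v_0)=\sum_{j\ge1}a^j\int_{-1}^{v_0}\!\!\cdots\int_{-1}^{v_{j-1}}\bigl(W_{v_j-k-j}-W_{-k-j-1}\bigr)\,dv_j\cdots dv_1 ,$$ let $r(s)=0$ for $s<0$ and $r(s)=\sum_{l=0}^{\lfloor s\rfloor}\frac{a^l}{l!}(s-l)^l$ for $s\ge0$, and let $$q(v)=\sum_{k\ge0}\bigl(p_k(0)+W_{-k}-W_{-k-1}\bigr)\,r(v+k),\qquad v\le 0 .$$ Let $\tilde X_v=\sum_{k\ge0}\bigl(p_k(v+k)+W_v-W_{-k-1}\bigr)\mathbf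 1_{[-k-1,-k)}(v)+q(v)$ for $v\le0$ and extend $\tilde X$ to $[0,\infty)$ by the method of steps, $$\tilde X_s=\tilde X_n+a\int_n^s\tilde X_{u-1}\,du+W_s-W_n,\qquad n<s\le n+1,\ n\in\mathbb Z_+ .$$ Set $b_0(W)=\tilde X_0(W)-W_0$ and $X=\tilde X-b_0$. *The process with anticipation* is $W\mapsto\bigl(X_{-s}(W_{-\,\cdot})\bigr)_{s\in\mathbb R}$, where $X$ is the process with delay and $W_{-\,\cdot}$ is the time-reversed path. Then the following holds. 1. For $Q$-a.e. $W$ the trajectory of the process with delay is continuous, $X_0=W_0$, and $dX_s=a(X_{s-1}+b_0(W))\,ds+dW_s$, $s\in\mathbb R$. For $Q$-a.e. $W$ the trajectory of the process with anticipation is continuous, $X_0=W_0$, and $dX_s=-a(X_{s+1}+b_0(W_{-\,\cdot}))\,ds+dW_s$, $s\in\mathbb R$. Both maps $W\mapsto X(W)$ (given an arbitrary continuous value, here $0$, on the null set where the trajectory is not continuous) are $Q$-measurable as maps from $\Omega$ to $\Omega$. 2. Let $X$ be either of the two processes and $P_\mu=Q\circ X^{-1}$ its law. For every $t\in\mathbb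 R$ the measure $P_\mu(dX_{\cdot-t})$, that is $B\mapsto P_\mu(\{x_{\cdot-t}:x\in B\})$, is absolutely continuous with respect to $P_\mu$, and $P_\mu$-a.e. $$\rho_{-t}(X):=\frac{P_\mu(dX_{\cdot-t})}{P_\mu(dX)}=\frac{m(X_{-t})}{m(X_0)} .$$ Equivalently, the law of the shifted process $(X_{s-t})_{s\in\mathbb R}$, that is $B\mapsto Q(\{W:X_{\cdot-t}(W)\in B\})$, is absolutely continuous with respect to $P_\mu$ with density $m(X_t)/m(X_0)$. -/

import Mathlib

open MeasureTheory ProbabilityTheory Filter Topology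
open scoped NNReal ENNReal

namespace DelayOU

/-- The Borel sigma-algebra of `C(ℝ, ℝ)` for uniform convergence on compact sets
(the compact-open topology). -/
instance instMeasurableSpacePath : MeasurableSpace C(ℝ, ℝ) := borel _

instance instBorelSpacePath : BorelSpace C(ℝ, ℝ) := ⟨rfl⟩

/-- `Q` is the law on path space of two-sided Brownian motion with initial distribution `ν`:
`W 0` has law `ν` and is independent of `(W s - W 0)`, `s ∈ ℝ`, and the two one-sided processes
`W s - W 0` and `W (-s) - W 0`, `s ≥ 0`, are independent standard Brownian motions. -/
structure IsTwoSidedBrownian (ν : Measure ℝ) (Q : Measure C(ℝ, ℝ)) : Prop where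
  initial : Q.map (fun W : C(ℝ, ℝ) => W 0) = ν
  indep_initial : IndepFun (fun W : C(ℝ, ℝ) => W 0) (fun (W : C(ℝ, ℝ)) (s : ℝ) => W s - W 0) Q
  forward : IsBrownianReal (fun (s : ℝ≥0) (W : C(ℝ, ℝ)) => W (s : ℝ) - W 0) Q
  backward : IsBrownianReal (fun (s : ℝ≥0) (W : C(ℝ, ℝ)) => W (-(s : ℝ)) - W 0) Q
  indep_sides : IndepFun (fun (W : C(ℝ, ℝ)) (s : ℝ≥0) => W (s : ℝ) - W 0)
    (fun (W : C(ℝ, ℝ)) (s : ℝ≥0) => W (-(s : ℝ)) - W 0) Q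

/-- `timeShift u x` is the path `x (· + u)`. -/
def timeShift (u : ℝ) (x : C(ℝ, ℝ)) : C(ℝ, ℝ) := x.comp ⟨fun s => s + u, by fun_prop⟩

/-- `timeReverse x` is the path `x (-·)`. -/
def timeReverse (x : C(ℝ, ℝ)) : C(ℝ, ℝ) := x.comp ⟨fun s => -s, by fun_prop⟩

lemma measurable_timeShift (u : ℝ) : Measurable (timeShift u) :=
  (ContinuousMap.continuous_precomp _).measurable

/-- The measure written `P(dX_{· - t})`, that is, `B ↦ P {X_{· - t} : X ∈ B}`,
see `shiftedMeasure_apply`. -/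
noncomputable def shiftedMeasure (P : Measure C(ℝ, ℝ)) (t : ℝ) : Measure C(ℝ, ℝ) :=
  P.map (timeShift t)

lemma shiftedMeasure_apply (P : Measure C(ℝ, ℝ)) (t : ℝ) {B : Set C(ℝ, ℝ)}
    (hB : MeasurableSet B) : shiftedMeasure P t B = P (timeShift (-t) '' B) := by
  rw [shiftedMeasure, Measure.map_apply (measurable_timeShift t) hB]
  congr 1
  ext x
  constructor
  · intro hx
    refine ⟨timeShift t x, hx, ?_⟩
    ext s
    simp [timeShift]
  · rintro ⟨y, hy, rfl⟩
    have h : timeShift t (timeShift (-t) y) = y := by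
      ext s
      simp [timeShift]
    simpa [h] using hy

/-! ### The construction of the process -/

/-- `j`-fold iterated integral of `g` from `-1`:
`iterInt j g v₀ = ∫_{-1}^{v₀} ⋯ ∫_{-1}^{v_{j-1}} g (v_j) dv_j ⋯ dv_1`. -/
noncomputable def iterInt : ℕ → (ℝ → ℝ) → ℝ → ℝ
  | 0, g => g
  | j + 1, g => fun v => ∫ u in (-1)..v, iterInt j g u

/-- `W (v - n) - W (-n - 1)`, used for `v ∈ [-1, 0]`. -/
def segInc (W : C(ℝ, ℝ)) (n : ℕ) (v : ℝ) : ℝ := W (v - n) - W (-(n : ℝ) - 1)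

/-- The function `p_k` on `[-1, 0]`,
`p_k(v₀) = ∑_{j ≥ 1} a ^ j ∫_{-1}^{v₀} ⋯ ∫_{-1}^{v_{j-1}} (W (v_j - k - j) - W (-k - j - 1)) dv_j ⋯ dv_1`. -/
noncomputable def p (a : ℝ) (W : C(ℝ, ℝ)) (k : ℕ) (v : ℝ) : ℝ :=
  ∑' j : ℕ, a ^ (j + 1) * iterInt (j + 1) (segInc W (k + (j + 1))) v

/-- The fundamental solution of `dr(s) = a r(s - 1) ds`: `r(s) = 0` for `s < 0` and
`r(s) = ∑_{l = 0}^{⌊s⌋} a ^ l / l! (s - l) ^ l` for `s ≥ 0`. -/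
noncomputable def r (a s : ℝ) : ℝ :=
  if s < 0 then 0
  else ∑ l ∈ Finset.range (⌊s⌋₊ + 1), a ^ l / (l.factorial : ℝ) * (s - l) ^ l

/-- `q(v) = ∑_{k ≥ 0} (p_k(0) + W (-k) - W (-k - 1)) r(v + k)`, for `v ≤ 0`. -/
noncomputable def q (a : ℝ) (W : C(ℝ, ℝ)) (v : ℝ) : ℝ :=
  ∑' k : ℕ, (p a W k 0 - W (-(k : ℝ) - 1) + W (-(k : ℝ))) * r a (v + k)

/-- The solution on the left half-axis. At `v = 0` no indicator contributes and the value is `q(0)`;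
this is the continuous extension from the left, as the jump of `q` at `0` (coming from
`r(0) = 1`) is the left limit at `0` of the first sum. -/
noncomputable def leftPath (a : ℝ) (W : C(ℝ, ℝ)) (v : ℝ) : ℝ :=
  (∑' k : ℕ, Set.indicator (Set.Ico (-(k : ℝ) - 1) (-(k : ℝ)))
    (fun w => p a W k (w + k) - W (-(k : ℝ) - 1) + W w) v) + q a W v

/-- Method of steps: `stepPath a W n` is the solution of `dY_s = a Y_{s-1} ds + dW_s` on `(-∞, n]`
which extends `leftPath a W`. -/
noncomputable def stepPath (a : ℝ) (W : C(ℝ, ℝ)) : ℕ → ℝ → ℝ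
  | 0 => leftPath a W
  | n + 1 => fun s =>
      if s ≤ n then stepPath a W n s
      else stepPath a W n n + a * (∫ u in (n : ℝ)..s, stepPath a W n (u - 1)) + (W s - W n)

/-- The two-sided process `Y` with `dY_s = a Y_{s-1} ds + dW_s`, `s ∈ ℝ`. -/
noncomputable def baseProcess (a : ℝ) (W : C(ℝ, ℝ)) (s : ℝ) : ℝ := stepPath a W ⌈s⌉₊ s

/-- The random constant `b₀(W) = Y_0(W) - W_0`. -/
noncomputable def b0 (a : ℝ) (W : C(ℝ, ℝ)) : ℝ := baseProcess a W 0 - W 0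

/-- The trajectory `X_s = Y_s - b₀` of the process with delay. -/
noncomputable def delayPath (a : ℝ) (W : C(ℝ, ℝ)) (s : ℝ) : ℝ := baseProcess a W s - b0 a W

/-- The trajectory of the process with anticipation, obtained by time reversal. -/
noncomputable def anticipationPath (a : ℝ) (W : C(ℝ, ℝ)) (s : ℝ) : ℝ :=
  delayPath a (timeReverse W) (-s)

open Classical in
/-- A function `ℝ → ℝ` as a point of path space; the value off the continuous functions is
irrelevant. -/
noncomputable def toPath (x : ℝ → ℝ) : C(ℝ, ℝ) := if h : Continuous x then ⟨x, h⟩ else 0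

/-- The Ornstein-Uhlenbeck type process with delay, as a map `W ↦ X(W)` of path space. -/
noncomputable def delayOU (a : ℝ) (W : C(ℝ, ℝ)) : C(ℝ, ℝ) := toPath (delayPath a W)

/-- The Ornstein-Uhlenbeck type process with anticipation, as a map `W ↦ X(W)` of path space. -/
noncomputable def anticipationOU (a : ℝ) (W : C(ℝ, ℝ)) : C(ℝ, ℝ) := toPath (anticipationPath a W)

/-- `dx_s = a (x_{s-1} + b) ds + dW_s`, `s ∈ ℝ`, in integrated form. -/
def SolvesDelay (a b : ℝ) (W x : C(ℝ, ℝ)) : Prop :=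
  ∀ u s : ℝ, x s - x u = (∫ v in u..s, a * (x (v - 1) + b)) + (W s - W u)

/-- `dx_s = -a (x_{s+1} + b) ds + dW_s`, `s ∈ ℝ`, in integrated form. -/
def SolvesAnticipation (a b : ℝ) (W x : C(ℝ, ℝ)) : Prop :=
  ∀ u s : ℝ, x s - x u = (∫ v in u..s, -a * (x (v + 1) + b)) + (W s - W u)

end DelayOU

namespace DelayOU

/-! For `-1 < a < 0` the equation `x' = a x(· - 1)` is stable with an elementary contraction: `|x
s|` is at most `θ = max (-a) (1 + a) < 1` times the supremum of `|x|` over `[s - 4, s - 1]`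
(`abs_le_of_delay`). This has two consequences. The fundamental solution decays exponentially
(`exists_rExt_le`), so all series in the construction converge once the driving path grows at most
linearly at `-∞`. And an entire solution of linear growth at `-∞` is determined by the increments of
its driving path (`eq_of_delay`). Brownian paths have this growth almost surely by time inversion
(`ae_leftGrowth`), so the explicit formula almost surely gives the unique such solution.

Hence `X = W 0 + Z(incr W)` with `Z` a Borel functional of the increments, and uniqueness makes `Z`
equivariant: shifting `Z w` in time gives, up to an additive constant, `Z` of the recentred shift of
`w` (`exists_delayOU_eq`). The law of the increments is shift invariant (`map_incr_timeShift`),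
since a centred Gaussian law is determined by its covariance.

With `W 0` independent of the increments and of density `m`, a time shift therefore only translates
the initial value `c` by a functional of the increments. Lebesgue measure is translation invariant,
so the translation survives only in the weight `m c`. Expressed on the shifted path `x`, the old
initial value is `x t`, while the weight of the unshifted law is `m (x 0)`; the density is thus `m
(x t) / m (x 0)` (`map_timeShift_eq_withDensity`). The process with anticipation follows by time
reversal, which preserves two-sided Brownian motion. -/

/-- At most linear growth at `-∞`. -/
def LeftGrowth (x : ℝ → ℝ) : Prop := ∃ C : ℝ, ∀ s ≤ 0, |x s| ≤ C * (1 - s)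

/-! ### Stability of the delay equation -/

/-- For `x' = -c x(· - 1)` on `[s - 3, s]`, a positive value `x s` is at most `max c (1 - c)` times
a bound for `|x|` on `[s - 4, s - 1]`. -/
lemma le_of_delay_of_pos {c s M : ℝ} (hc0 : 0 < c) (hc1 : c < 1) {x : ℝ → ℝ} (hx : Continuous x)
    (heq : ∀ u v, s - 3 ≤ u → u ≤ v → v ≤ s → x v - x u = -c * ∫ w in u..v, x (w - 1))
    (hM : ∀ v, s - 4 ≤ v → v ≤ s - 1 → |x v| ≤ M) (hs : 0 < x s) :
    x s ≤ max c (1 - c) * M := by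
  have hM0 : 0 ≤ M := (abs_nonneg _).trans (hM (s - 1) (by linarith) le_rfl)
  have hint : ∀ u v : ℝ, IntervalIntegrable (fun w => x (w - 1)) volume u v := fun u v =>
    (hx.comp (continuous_id.sub continuous_const)).intervalIntegrable u v
  -- a zero controls the solution on the following unit interval
  have hzero : ∀ z v, s - 3 ≤ z → z ≤ v → v ≤ s → v ≤ z + 1 → x z = 0 → x v ≤ c * M := by
    intro z v hz hzv hvs hv1 hxz
    have h := heq z v hz hzv hvs
    have hb : ‖∫ w in z..v, x (w - 1)‖ ≤ M * |v - z| := by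
      apply intervalIntegral.norm_integral_le_of_norm_le_const
      intro w hw
      rw [Set.uIoc_of_le hzv] at hw
      exact hM _ (by linarith [hw.1]) (by linarith [hw.2])
    rw [Real.norm_eq_abs, abs_of_nonneg (by linarith : (0 : ℝ) ≤ v - z)] at hb
    have h2 : M * (v - z) ≤ M * 1 := by gcongr; linarith
    have h3 := neg_le_of_abs_le hb
    nlinarith
  -- positivity makes the solution antitone one time unit later
  have hanti : ∀ z u v, s - 3 ≤ z → (∀ w, z < w → w ≤ s → 0 < x w) → z + 1 ≤ u → u ≤ v → v ≤ s →
      x v ≤ x u := by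
    intro z u v hz hpos hzu huv hvs
    have h := heq u v (by linarith) huv hvs
    have : 0 ≤ ∫ w in u..v, x (w - 1) := by
      rw [intervalIntegral.integral_of_le huv]
      refine setIntegral_nonneg measurableSet_Ioc fun w hw => ?_
      exact (hpos _ (by linarith [hw.1]) (by linarith [hw.2])).le
    nlinarith
  have hivt : ∀ z, z ≤ s → (∀ w, z < w → w ≤ s → x w ≠ 0) → ∀ w, z < w → w ≤ s → 0 < x w := by
    intro z _ hne w hzw hws
    by_contra! hle
    obtain ⟨y, hy, hy0⟩ := intermediate_value_Icc hws hx.continuousOn ⟨hle, hs.le⟩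
    exact hne y (hzw.trans_le hy.1) hy.2 hy0
  -- After its last zero in `[s - 3, s]` the solution can climb to at most `c * M` within one time
  -- unit and then decreases. Without a zero it is positive on `(s - 3, s]`, hence antitone on `[s -
  -- 2, s]`, and the last unit step removes at least `c * x (s - 1)`. The delayed argument reaches
  -- back to `s - 4`.
  by_cases hZ : ∃ z ∈ Set.Icc (s - 3) s, x z = 0
  · have hcomp : IsCompact (Set.Icc (s - 3) s ∩ x ⁻¹' {0}) :=
      isCompact_Icc.inter_right (isClosed_singleton.preimage hx)
    obtain ⟨z, ⟨hz1, hz0⟩, hzmax⟩ := hcomp.exists_isGreatest (by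
      obtain ⟨z, hz, h0⟩ := hZ
      exact ⟨z, hz, h0⟩)
    have hpos := hivt z hz1.2 fun w hzw hws h0 =>
      absurd (hzmax ⟨⟨by linarith [hz1.1], hws⟩, h0⟩) (not_le.2 hzw)
    refine le_trans ?_ (mul_le_mul_of_nonneg_right (le_max_left c (1 - c)) hM0)
    rcases le_total s (z + 1) with h | h
    · exact hzero z s hz1.1 hz1.2 le_rfl h hz0
    · exact (hanti z (z + 1) s hz1.1 hpos le_rfl h le_rfl).trans
        (hzero z (z + 1) hz1.1 (by linarith) h le_rfl hz0)
  · have hpos := hivt (s - 3) (by linarith) fun w hw hws h0 => hZ ⟨w, ⟨hw.le, hws⟩, h0⟩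
    refine le_trans ?_ (mul_le_mul_of_nonneg_right (le_max_right c (1 - c)) hM0)
    have h := heq (s - 1) s (by linarith) (by linarith) le_rfl
    have h1 : ∫ _ in (s - 1)..s, x (s - 1) ≤ ∫ w in (s - 1)..s, x (w - 1) := by
      refine intervalIntegral.integral_mono_on (by linarith) (by simp) (hint _ _) fun w hw => ?_
      exact hanti (s - 3) (w - 1) (s - 1) le_rfl hpos (by linarith [hw.1]) (by linarith [hw.2])
        (by linarith)
    rw [intervalIntegral.integral_const, smul_eq_mul, sub_sub_cancel, one_mul] at h1
    have h2 := (le_abs_self _).trans (hM (s - 1) (by linarith) le_rfl)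
    have h3 : x s ≤ (1 - c) * x (s - 1) := by nlinarith
    exact h3.trans (mul_le_mul_of_nonneg_left h2 (by linarith))

/-- The equation is linear, so the one-sided bound also applies to `-x`. For `0 < c < 1` the factor
is strictly less than one. -/
lemma abs_le_of_delay {c s M : ℝ} (hc0 : 0 < c) (hc1 : c < 1) {x : ℝ → ℝ} (hx : Continuous x)
    (heq : ∀ u v, s - 3 ≤ u → u ≤ v → v ≤ s → x v - x u = -c * ∫ w in u..v, x (w - 1))
    (hM : ∀ v, s - 4 ≤ v → v ≤ s - 1 → |x v| ≤ M) :
    |x s| ≤ max c (1 - c) * M := by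
  have hM0 : 0 ≤ M := (abs_nonneg _).trans (hM (s - 1) (by linarith) le_rfl)
  rcases lt_trichotomy (x s) 0 with h | h | h
  · rw [abs_of_neg h]
    refine le_of_delay_of_pos hc0 hc1 (x := fun v => -x v) hx.neg (fun u v h1 h2 h3 => ?_)
      (fun v h1 h2 => by simpa using hM v h1 h2) (by linarith)
    rw [intervalIntegral.integral_neg]
    linarith [heq u v h1 h2 h3]
  · rw [h, abs_zero]
    exact mul_nonneg (hc0.le.trans (le_max_left _ _)) hM0
  · rw [abs_of_pos h]
    exact le_of_delay_of_pos hc0 hc1 hx heq hM h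

/-- The delay equation has no nonzero entire solution of linear growth at `-∞`. -/
lemma eq_zero_of_delay {a : ℝ} (ha : -1 < a) (ha0 : a < 0) {x : ℝ → ℝ} (hx : Continuous x)
    (heq : ∀ u v, x v - x u = a * ∫ w in u..v, x (w - 1)) (hgrow : LeftGrowth x) :
    ∀ s, x s = 0 := by
  obtain ⟨C, hC⟩ := hgrow
  set θ : ℝ := max (-a) (1 - -a) with hθ
  have hθ0 : 0 ≤ θ := (neg_pos.2 ha0).le.trans (le_max_left _ _)
  have hθ1 : θ < 1 := max_lt (by linarith) (by linarith)
  have hcontr : ∀ s M : ℝ, (∀ v, s - 4 ≤ v → v ≤ s - 1 → |x v| ≤ M) → |x s| ≤ θ * M :=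
    fun s M hM => abs_le_of_delay (neg_pos.2 ha0) (by linarith) hx
      (fun u v _ _ _ => by rw [heq u v, neg_neg]) hM
  have hC0 : 0 ≤ C := by simpa using (abs_nonneg _).trans (hC 0 le_rfl)
  -- Each use of the contraction gains a factor `θ` and looks at most four units further left, where
  -- the linear bound has grown by `4 * C`; the geometric factor wins in the limit.
  have hiter : ∀ n : ℕ, ∀ s ≤ 0, |x s| ≤ θ ^ n * (C * (1 - s + 4 * n)) := by
    intro n
    induction n with
    | zero => intro s hs; simpa using hC s hs
    | succ n ih =>
      intro s hs
      refine (hcontr s (θ ^ n * (C * (1 - s + 4 * (n + 1 : ℕ)))) fun v h1 h2 => ?_).trans_eq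
        (by ring)
      refine (ih v (by linarith)).trans ?_
      push_cast
      exact mul_le_mul_of_nonneg_left (mul_le_mul_of_nonneg_left (by linarith) hC0)
        (pow_nonneg hθ0 n)
  have hneg : ∀ s ≤ 0, x s = 0 := by
    intro s hs
    have h1 : Tendsto (fun n : ℕ => θ ^ n * (C * (1 - s + 4 * n))) atTop (𝓝 0) := by
      have e1 := (tendsto_pow_atTop_nhds_zero_of_lt_one hθ0 hθ1).mul_const (C * (1 - s))
      have e2 := (tendsto_self_mul_const_pow_of_lt_one hθ0 hθ1).mul_const (4 * C)
      have e := e1.add e2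
      simp only [zero_mul, add_zero] at e
      refine e.congr fun n => ?_
      ring
    have := ge_of_tendsto' h1 fun n => hiter n s hs
    exact abs_eq_zero.1 (le_antisymm this (abs_nonneg _))
  -- Once `x` vanishes up to `n`, the contraction with `M = 0` extends this to `n + 1`, because it
  -- only looks at times up to `s - 1`.
  have hall : ∀ n : ℕ, ∀ s ≤ (n : ℝ), x s = 0 := by
    intro n
    induction n with
    | zero => simpa using hneg
    | succ n ih =>
      intro s hs
      push_cast at hs
      have := hcontr s 0 fun v _ h2 => by rw [ih v (by linarith), abs_zero]
      rw [mul_zero] at this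
      exact abs_eq_zero.1 (le_antisymm this (abs_nonneg _))
  intro s
  obtain ⟨n, hn⟩ := exists_nat_ge s
  exact hall n s hn

/-! ### The fundamental solution -/

/-- The continuous extension of `r a` from `[0, ∞)` by the value `1`. -/
noncomputable def rExt (a s : ℝ) : ℝ := r a (max s 0)

/-- The terms up to `N` of the fundamental solution. -/
noncomputable def rTrunc (a : ℝ) (N : ℕ) (s : ℝ) : ℝ :=
  ∑ l ∈ Finset.range (N + 1), a ^ l / (l.factorial : ℝ) * (max (s - l) 0) ^ l

lemma continuous_rTrunc (a : ℝ) (N : ℕ) : Continuous (rTrunc a N) := by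
  unfold rTrunc
  fun_prop

lemma r_eq_rTrunc (a : ℝ) {N : ℕ} {s : ℝ} (hs : 0 ≤ s) (hN : s < N + 1) : r a s = rTrunc a N s := by
  have hfl : ⌊s⌋₊ + 1 ≤ N + 1 := by
    have : ⌊s⌋₊ < N + 1 := (Nat.floor_lt hs).2 (by exact_mod_cast hN)
    omega
  rw [r, if_neg (not_lt.2 hs), rTrunc]
  rw [← Finset.sum_subset (Finset.range_mono hfl)]
  · refine Finset.sum_congr rfl fun l hl => ?_
    have : (l : ℝ) ≤ s := by
      have h1 : l ≤ ⌊s⌋₊ := by simpa [Nat.lt_succ_iff] using hl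
      exact (Nat.cast_le.2 h1).trans (Nat.floor_le hs)
    rw [max_eq_left (by linarith)]
  · intro l _ hl
    have h1 : ⌊s⌋₊ < l := by simpa [Nat.lt_succ_iff] using hl
    have h2 : s < l := (Nat.floor_lt hs).1 h1
    rw [max_eq_right (by linarith), zero_pow (by omega), mul_zero]

lemma rTrunc_max (a : ℝ) (N : ℕ) (s : ℝ) : rTrunc a N (max s 0) = rTrunc a N s := by
  unfold rTrunc
  refine Finset.sum_congr rfl fun l _ => ?_
  rcases Nat.eq_zero_or_pos l with rfl | hl
  · simp
  · rcases le_total 0 s with h | h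
    · rw [max_eq_left h]
    · have : (0 : ℝ) < l := by exact_mod_cast hl
      rw [max_eq_right h, max_eq_right (by linarith), max_eq_right (by linarith)]

/-- Positive parts kill the terms with `l > s`, `l ≥ 1`, while the term `l = 0` is a zeroth power
and stays `1` for negative `s`. So one finite sum represents `rExt` on a whole left half-line, which
yields continuity and termwise integration. -/
lemma rExt_eq_rTrunc (a : ℝ) {N : ℕ} {s : ℝ} (hN : s < N + 1) : rExt a s = rTrunc a N s := by
  rw [rExt, r_eq_rTrunc a (le_max_right _ _) (max_lt hN (by positivity)), rTrunc_max]

lemma rExt_of_nonneg (a : ℝ) {s : ℝ} (hs : 0 ≤ s) : rExt a s = r a s := by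
  rw [rExt, max_eq_left hs]

lemma rExt_of_le_one (a : ℝ) {s : ℝ} (hs : s ≤ 1) : rExt a s = 1 := by
  rw [rExt_eq_rTrunc a (N := 1) (by push_cast; linarith)]
  simp [rTrunc, Finset.sum_range_succ, hs]

lemma continuous_rExt (a : ℝ) : Continuous (rExt a) := by
  rw [continuous_iff_continuousAt]
  intro s
  obtain ⟨N, hN⟩ := exists_nat_ge s
  refine (continuous_rTrunc a N).continuousAt.congr ?_
  filter_upwards [Iio_mem_nhds (show s < N + 1 by linarith)] with v hv
  exact (rExt_eq_rTrunc a hv).symm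

lemma integral_max_pow (l : ℕ) {s : ℝ} (hs : 1 ≤ s) :
    ∫ v in (1 : ℝ)..s, (max (v - 1 - l) 0) ^ l = (max (s - 1 - l) 0) ^ (l + 1) / (l + 1) := by
  have hpow : ∀ t : ℝ, (l : ℝ) + 1 ≤ t →
      ∫ v in ((l : ℝ) + 1)..t, (max (v - 1 - l) 0) ^ l = (t - 1 - l) ^ (l + 1) / (l + 1) := by
    intro t ht
    have : ∫ v in ((l : ℝ) + 1)..t, (max (v - 1 - l) 0) ^ l
        = ∫ v in ((l : ℝ) + 1)..t, (v - (1 + l)) ^ l := by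
      refine intervalIntegral.integral_congr fun v hv => ?_
      rw [Set.uIcc_of_le ht] at hv
      rw [max_eq_left (by linarith [hv.1]), sub_sub]
    rw [this, intervalIntegral.integral_comp_sub_right (fun v => v ^ l), integral_pow]
    simp [sub_sub, add_comm]
  rcases Nat.eq_zero_or_pos l with rfl | hl
  · have := hpow s (by simpa using hs)
    simp only [Nat.cast_zero, zero_add, sub_zero] at this ⊢
    rw [this, max_eq_left (by linarith)]
  have hzero : ∀ t : ℝ, 1 ≤ t → t ≤ l + 1 → ∫ v in (1 : ℝ)..t, (max (v - 1 - l) 0) ^ l = 0 := by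
    intro t ht htl
    rw [intervalIntegral.integral_congr (g := fun _ => 0), intervalIntegral.integral_zero]
    intro v hv
    rw [Set.uIcc_of_le ht] at hv
    dsimp only
    rw [max_eq_right (by linarith [hv.2]), zero_pow (by omega)]
  rcases le_total s (l + 1) with h | h
  · rw [hzero s hs h, max_eq_right (by linarith)]
    simp
  · have hc : Continuous fun v : ℝ => (max (v - 1 - l) 0) ^ l := by fun_prop
    rw [← intervalIntegral.integral_add_adjacent_intervals (hc.intervalIntegrable 1 (l + 1))
      (hc.intervalIntegrable (l + 1) s), hzero _ (by simp) le_rfl, hpow s h,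
      max_eq_left (by linarith), zero_add]

/-- Integrating the delayed `l`-th term and multiplying by `a` gives the `(l + 1)`-st term. -/
lemma rTrunc_succ (a : ℝ) (N : ℕ) {s : ℝ} (hs : 1 ≤ s) :
    rTrunc a (N + 1) s = 1 + a * ∫ v in (1 : ℝ)..s, rTrunc a N (v - 1) := by
  unfold rTrunc
  rw [intervalIntegral.integral_finsetSum fun l _ => Continuous.intervalIntegrable
    (by fun_prop) _ _, Finset.sum_range_succ', Finset.mul_sum, add_comm]
  congr 1
  · simp
  refine Finset.sum_congr rfl fun l _ => ?_
  rw [intervalIntegral.integral_const_mul, integral_max_pow l hs, Nat.factorial_succ]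
  push_cast
  rw [show s - ((l : ℝ) + 1) = s - 1 - l by ring]
  field_simp
  ring

lemma rExt_eq_integral (a : ℝ) {s : ℝ} (hs : 1 ≤ s) :
    rExt a s = 1 + a * ∫ v in (1 : ℝ)..s, rExt a (v - 1) := by
  obtain ⟨N, hN⟩ := exists_nat_ge s
  rw [rExt_eq_rTrunc a (N := N + 1) (by push_cast; linarith), rTrunc_succ a N hs]
  congr 2
  refine intervalIntegral.integral_congr fun v hv => ?_
  rw [Set.uIcc_of_le hs] at hv
  exact (rExt_eq_rTrunc a (by linarith [hv.2])).symm

/-- The equation only starts at time `1`: before that `rExt` is constant although its delayed value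
is `1`. -/
lemma rExt_sub (a : ℝ) {u s : ℝ} (hu : 1 ≤ u) (hs : 1 ≤ s) :
    rExt a s - rExt a u = a * ∫ v in u..s, rExt a (v - 1) := by
  have hi : ∀ u s : ℝ, IntervalIntegrable (fun v => rExt a (v - 1)) volume u s := fun u s =>
    ((continuous_rExt a).comp (continuous_id.sub continuous_const)).intervalIntegrable u s
  rw [rExt_eq_integral a hs, rExt_eq_integral a hu,
    ← intervalIntegral.integral_interval_sub_left (hi 1 s) (hi 1 u)]
  ring

/-- The contraction gains `θ` per four time units, so the rate `t` is chosen with `θ = exp (-4 t)`.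
For `s ≥ 4` the window `[s - 3, s]` lies in `[1, ∞)`, where the equation holds; the interval `[0,
4]` is covered by compactness. -/
lemma exists_rExt_le {a : ℝ} (ha : -1 < a) (ha0 : a < 0) :
    ∃ C ρ : ℝ, 0 ≤ C ∧ 0 < ρ ∧ ρ < 1 ∧ ∀ (i : ℕ) (s : ℝ), i ≤ s → |rExt a s| ≤ C * ρ ^ i := by
  set θ : ℝ := max (-a) (1 - -a) with hθ
  have hθ0 : 0 < θ := (neg_pos.2 ha0).trans_le (le_max_left _ _)
  have hθ1 : θ < 1 := max_lt (by linarith) (by linarith)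
  set t : ℝ := -Real.log θ / 4 with ht
  have ht0 : 0 < t := by have := Real.log_neg hθ0 hθ1; rw [ht]; linarith
  have hθt : θ = Real.exp (-(4 * t)) := by
    rw [ht, show -(4 * (-Real.log θ / 4)) = Real.log θ by ring, Real.exp_log hθ0]
  obtain ⟨B, hB⟩ := isCompact_Icc.exists_bound_of_continuousOn (s := Set.Icc (0 : ℝ) 4)
    (continuous_rExt a).continuousOn
  have hB0 : 0 ≤ B := (norm_nonneg _).trans (hB 0 (by simp))
  set C : ℝ := B * Real.exp (4 * t) with hC
  have hC0 : 0 ≤ C := by positivity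
  have key : ∀ n : ℕ, ∀ s : ℝ, 0 ≤ s → s ≤ n + 4 → |rExt a s| ≤ C * Real.exp (-(t * s)) := by
    intro n
    induction n with
    | zero =>
      intro s hs hs4
      rw [Nat.cast_zero, zero_add] at hs4
      refine (hB s ⟨hs, hs4⟩).trans ?_
      rw [hC, mul_assoc, ← Real.exp_add]
      refine le_mul_of_one_le_right hB0 (Real.one_le_exp ?_)
      nlinarith
    | succ n ih =>
      intro s hs hsn
      push_cast at hsn
      rcases le_total s (n + 4) with h | h
      · exact ih s hs h
      have hs4 : (4 : ℝ) ≤ s := by have : (0 : ℝ) ≤ n := n.cast_nonneg; linarith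
      have := abs_le_of_delay (neg_pos.2 ha0) (by linarith) (continuous_rExt a) (s := s)
        (M := C * Real.exp (-(t * (s - 4))))
        (fun u v h1 h2 h3 => by rw [rExt_sub a (by linarith) (by linarith), neg_neg])
        (fun v h1 h2 => (ih v (by linarith) (by linarith)).trans
          (mul_le_mul_of_nonneg_left (Real.exp_le_exp.2 (by nlinarith)) hC0))
      refine this.trans_eq ?_
      rw [← hθ, hθt, mul_left_comm, ← Real.exp_add]
      congr 2
      ring
  refine ⟨C, Real.exp (-t), hC0, Real.exp_pos _, Real.exp_zero ▸ Real.exp_lt_exp.2 (by linarith),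
    fun i s hs => ?_⟩
  obtain ⟨n, hn⟩ := exists_nat_ge s
  refine (key n s ((Nat.cast_nonneg i).trans hs) (by linarith)).trans ?_
  rw [← Real.exp_nat_mul]
  exact mul_le_mul_of_nonneg_left (Real.exp_le_exp.2 (by nlinarith)) hC0

/-! ### Series of functions on `[-1, 0]` -/

lemma hasSum_integral_of_abs_le {f : ℕ → ℝ → ℝ} (hf : ∀ i, Continuous (f i)) {u : ℕ → ℝ}
    (hu : Summable u) (hfu : ∀ i, ∀ x ∈ Set.Icc (-1 : ℝ) 0, |f i x| ≤ u i)
    {x : ℝ} (hx : x ∈ Set.Icc (-1 : ℝ) 0) :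
    HasSum (fun i => ∫ v in (-1 : ℝ)..x, f i v) (∫ v in (-1 : ℝ)..x, ∑' i, f i v) := by
  have hmem : ∀ v ∈ Set.uIoc (-1 : ℝ) x, v ∈ Set.Icc (-1 : ℝ) 0 := by
    intro v hv
    rw [Set.uIoc_of_le hx.1] at hv
    exact ⟨hv.1.le, hv.2.trans hx.2⟩
  refine intervalIntegral.hasSum_integral_of_dominated_convergence (fun i _ => u i)
    (fun i => (hf i).aestronglyMeasurable) (fun i => .of_forall fun v hv => hfu i v (hmem v hv))
    (.of_forall fun _ _ => hu) (by simp) (.of_forall fun v hv => ?_)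
  exact (Summable.of_norm_bounded hu fun i => hfu i v (hmem v hv)).hasSum

lemma continuous_segInc (W : C(ℝ, ℝ)) (n : ℕ) : Continuous (segInc W n) := by
  unfold segInc
  fun_prop

lemma segInc_neg_one (W : C(ℝ, ℝ)) (n : ℕ) : segInc W n (-1) = 0 := by
  rw [segInc, sub_eq_zero]
  congr 1
  ring

lemma continuous_iterInt {g : ℝ → ℝ} (hg : Continuous g) (j : ℕ) : Continuous (iterInt j g) := by
  induction j with
  | zero => exact hg
  | succ j ih => exact intervalIntegral.continuous_primitive (fun _ _ => ih.intervalIntegrable _ _) _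

/-- Integrating over an interval of length at most one does not enlarge a bound. The factorial gain
is not needed, as the powers of `a` with `|a| < 1` provide summability. -/
lemma abs_iterInt_le {g : ℝ → ℝ} {M : ℝ} (hM : ∀ x ∈ Set.Icc (-1 : ℝ) 0, |g x| ≤ M) (j : ℕ) :
    ∀ x ∈ Set.Icc (-1 : ℝ) 0, |iterInt j g x| ≤ M := by
  have hM0 : 0 ≤ M := (abs_nonneg _).trans (hM 0 (by simp))
  induction j with
  | zero => exact hM
  | succ j ih =>
    intro x hx
    have := intervalIntegral.norm_integral_le_of_norm_le_const (a := -1) (b := x)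
      (f := iterInt j g) (C := M) fun v hv => by
        rw [Set.uIoc_of_le hx.1] at hv
        exact ih v ⟨hv.1.le, hv.2.trans hx.2⟩
    refine this.trans (mul_le_of_le_one_right hM0 ?_)
    rw [abs_of_nonneg (by linarith [hx.1])]
    linarith [hx.2]

lemma abs_segInc_le {W : C(ℝ, ℝ)} {C : ℝ} (hC : ∀ s ≤ 0, |W s| ≤ C * (1 - s)) (n : ℕ) :
    ∀ x ∈ Set.Icc (-1 : ℝ) 0, |segInc W n x| ≤ 2 * C * (n + 2) := by
  intro x hx
  have hn : (0 : ℝ) ≤ n := n.cast_nonneg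
  have hC0 : 0 ≤ C := by simpa using (abs_nonneg _).trans (hC 0 le_rfl)
  have h1 := hC (x - n) (by linarith [hx.2])
  have h2 := hC (-(n : ℝ) - 1) (by linarith)
  refine (abs_sub _ _).trans ?_
  have h3 : C * (1 - (x - n)) ≤ C * (n + 2) := mul_le_mul_of_nonneg_left (by linarith [hx.1]) hC0
  linarith

/-- The function `p_k + (W (· - k) - W (-k - 1))` on `[-1, 0]`. -/
noncomputable def segSol (a : ℝ) (W : C(ℝ, ℝ)) (k : ℕ) (x : ℝ) : ℝ :=
  ∑' j : ℕ, a ^ j * iterInt j (segInc W (k + j)) x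

lemma abs_segSol_term_le (a : ℝ) {W : C(ℝ, ℝ)} {C : ℝ}
    (hC : ∀ s ≤ 0, |W s| ≤ C * (1 - s)) (k j : ℕ) :
    ∀ x ∈ Set.Icc (-1 : ℝ) 0,
      |a ^ j * iterInt j (segInc W (k + j)) x| ≤ 2 * C * (k + 2) * ((j + 2) * |a| ^ j) := by
  intro x hx
  have hC0 : 0 ≤ C := by simpa using (abs_nonneg _).trans (hC 0 le_rfl)
  have h := abs_iterInt_le (abs_segInc_le hC (k + j)) j x hx
  have hk : (0 : ℝ) ≤ k := k.cast_nonneg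
  have hj : (0 : ℝ) ≤ j := j.cast_nonneg
  -- This separates `k`, which carries the linear growth, from `j`, which is absorbed by `|a| ^ j`.
  have h2 : 2 * C * (((k + j : ℕ) : ℝ) + 2) ≤ 2 * C * ((k + 2) * (j + 2)) := by
    push_cast
    exact mul_le_mul_of_nonneg_left (by nlinarith [mul_nonneg hk hj]) (by linarith)
  rw [abs_mul, abs_pow]
  calc |a| ^ j * |iterInt j (segInc W (k + j)) x|
      ≤ |a| ^ j * (2 * C * ((k + 2) * (j + 2))) :=
        mul_le_mul_of_nonneg_left (h.trans h2) (by positivity)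
    _ = _ := by ring

lemma summable_add_two_mul_pow {ρ : ℝ} (h : |ρ| < 1) :
    Summable fun j : ℕ => ((j : ℝ) + 2) * ρ ^ j := by
  have h1 := summable_pow_mul_geometric_of_norm_lt_one 1 (show ‖ρ‖ < 1 from h)
  have h2 := (summable_geometric_of_norm_lt_one (show ‖ρ‖ < 1 from h)).mul_left 2
  refine (h1.add h2).congr fun j => ?_
  ring

section Left

variable {a : ℝ} {W : C(ℝ, ℝ)}

lemma summable_segSol_bound (ha : |a| < 1) (C : ℝ) :
    Summable fun j : ℕ => C * (((j : ℝ) + 2) * |a| ^ j) :=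
  (summable_add_two_mul_pow (by rwa [abs_abs])).mul_left _

lemma exists_abs_segSol_le (ha : |a| < 1) (hW : LeftGrowth W) :
    ∃ K : ℝ, 0 ≤ K ∧ ∀ (k : ℕ), ∀ x ∈ Set.Icc (-1 : ℝ) 0, |segSol a W k x| ≤ K * (k + 2) := by
  obtain ⟨C, hC⟩ := hW
  have hC0 : 0 ≤ C := by simpa using (abs_nonneg _).trans (hC 0 le_rfl)
  refine ⟨2 * C * ∑' j : ℕ, ((j : ℝ) + 2) * |a| ^ j, ?_, fun k x hx => ?_⟩
  · exact mul_nonneg (by linarith) (tsum_nonneg fun j => by positivity)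
  · have hs := (summable_segSol_bound ha (2 * C * (k + 2))).hasSum
    refine (tsum_of_norm_bounded (f := fun j => a ^ j * iterInt j (segInc W (k + j)) x) hs
      fun j => abs_segSol_term_le a hC k j x hx).trans_eq ?_
    rw [tsum_mul_left]
    ring

lemma continuousOn_segSol (ha : |a| < 1) (hW : LeftGrowth W) (k : ℕ) :
    ContinuousOn (segSol a W k) (Set.Icc (-1) 0) := by
  obtain ⟨C, hC⟩ := hW
  exact continuousOn_tsum
    (fun j => (continuous_const.mul (continuous_iterInt (continuous_segInc W _) j)).continuousOn)
    (summable_segSol_bound ha (2 * C * (k + 2))) (fun j x hx => abs_segSol_term_le a hC k j x hx)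

lemma segSol_eq_p_add (ha : |a| < 1) (hW : LeftGrowth W) (k : ℕ) {x : ℝ}
    (hx : x ∈ Set.Icc (-1 : ℝ) 0) : segSol a W k x = p a W k x + segInc W k x := by
  obtain ⟨C, hC⟩ := hW
  rw [segSol, Summable.tsum_eq_zero_add, p]
  · simp [iterInt, add_comm]
  · exact Summable.of_norm_bounded (summable_segSol_bound ha (2 * C * (k + 2)))
      fun j => abs_segSol_term_le a hC k j x hx

/-- Integrating the series for `k + 1` raises the depth of each iterated integral by one, which
reproduces the series for `k` without its zeroth term. So the `segSol` solve the delay equation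
piecewise, restarting from `0` at each left endpoint; `jumpSol` compensates the resulting jumps. -/
lemma segSol_eq (ha : |a| < 1) (hW : LeftGrowth W) (k : ℕ) {x : ℝ}
    (hx : x ∈ Set.Icc (-1 : ℝ) 0) :
    segSol a W k x = a * (∫ v in (-1 : ℝ)..x, segSol a W (k + 1) v) + segInc W k x := by
  rw [segSol_eq_p_add ha hW k hx]
  obtain ⟨C, hC⟩ := hW
  have h := hasSum_integral_of_abs_le
    (f := fun j x => a ^ j * iterInt j (segInc W (k + 1 + j)) x)
    (fun j => continuous_const.mul (continuous_iterInt (continuous_segInc W (k + 1 + j)) j))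
    (summable_segSol_bound ha (2 * C * ((k + 1 : ℕ) + 2)))
    (fun j x hx => abs_segSol_term_le a hC (k + 1) j x hx) hx
  congr 1
  refine Eq.trans ?_ (h.mul_left a).tsum_eq
  refine tsum_congr fun j => ?_
  rw [intervalIntegral.integral_const_mul, iterInt, show k + (j + 1) = k + 1 + j by omega]
  ring

lemma segSol_neg_one (ha : |a| < 1) (hW : LeftGrowth W) (k : ℕ) : segSol a W k (-1) = 0 := by
  rw [segSol_eq ha hW k (by simp), intervalIntegral.integral_same, segInc_neg_one]
  simp

/-- The tail of the series `q` on the `k`-th unit interval to the left of `0`. -/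
noncomputable def jumpSol (a : ℝ) (W : C(ℝ, ℝ)) (k : ℕ) (x : ℝ) : ℝ :=
  ∑' i : ℕ, segSol a W (k + 1 + i) 0 * rExt a (x + 1 + i)

lemma exists_abs_jumpSol_term_le (ha : -1 < a) (ha0 : a < 0) (hW : LeftGrowth W) :
    ∃ K ρ : ℝ, 0 ≤ K ∧ 0 < ρ ∧ ρ < 1 ∧ ∀ (k i : ℕ), ∀ x : ℝ, -1 ≤ x →
      |segSol a W (k + 1 + i) 0 * rExt a (x + 1 + i)| ≤ K * (k + 2) * ((i + 2) * ρ ^ i) := by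
  have ha1 : |a| < 1 := abs_lt.2 ⟨ha, by linarith⟩
  obtain ⟨K, hK0, hK⟩ := exists_abs_segSol_le ha1 hW
  obtain ⟨C, ρ, hC0, hρ0, hρ1, hρ⟩ := exists_rExt_le ha ha0
  refine ⟨K * C, ρ, mul_nonneg hK0 hC0, hρ0, hρ1, fun k i x hx => ?_⟩
  have h1 := hK (k + 1 + i) 0 (by simp)
  have h2 := hρ i (x + 1 + i) (by linarith)
  have hk : (0 : ℝ) ≤ k := k.cast_nonneg
  have hi : (0 : ℝ) ≤ i := i.cast_nonneg
  have h3 : K * (((k + 1 + i : ℕ) : ℝ) + 2) ≤ K * ((k + 2) * (i + 2)) := by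
    push_cast
    exact mul_le_mul_of_nonneg_left (by nlinarith [mul_nonneg hk hi]) hK0
  rw [abs_mul]
  calc |segSol a W (k + 1 + i) 0| * |rExt a (x + 1 + i)|
      ≤ (K * ((k + 2) * (i + 2))) * (C * ρ ^ i) :=
        mul_le_mul (h1.trans h3) h2 (abs_nonneg _) (by positivity)
    _ = _ := by ring

lemma summable_jumpSol (ha : -1 < a) (ha0 : a < 0) (hW : LeftGrowth W) (k : ℕ) {x : ℝ}
    (hx : -1 ≤ x) : Summable fun i : ℕ => segSol a W (k + 1 + i) 0 * rExt a (x + 1 + i) := by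
  obtain ⟨K, ρ, -, hρ0, hρ1, h⟩ := exists_abs_jumpSol_term_le ha ha0 hW
  exact Summable.of_norm_bounded ((summable_add_two_mul_pow (by rwa [abs_of_pos hρ0])).mul_left
    (K * (k + 2))) fun i => h k i x hx

lemma exists_abs_jumpSol_le (ha : -1 < a) (ha0 : a < 0) (hW : LeftGrowth W) :
    ∃ K : ℝ, 0 ≤ K ∧ ∀ (k : ℕ), ∀ x ∈ Set.Icc (-1 : ℝ) 0, |jumpSol a W k x| ≤ K * (k + 2) := by
  obtain ⟨K, ρ, hK0, hρ0, hρ1, h⟩ := exists_abs_jumpSol_term_le ha ha0 hW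
  have hs := summable_add_two_mul_pow (ρ := ρ) (by rwa [abs_of_pos hρ0])
  refine ⟨K * ∑' i : ℕ, ((i : ℝ) + 2) * ρ ^ i, mul_nonneg hK0 (tsum_nonneg fun i => by positivity),
    fun k x hx => ?_⟩
  refine (tsum_of_norm_bounded (f := fun i : ℕ => segSol a W (k + 1 + i) 0 * rExt a (x + 1 + i))
    (hs.mul_left (K * (k + 2))).hasSum fun i => h k i x hx.1).trans_eq ?_
  rw [tsum_mul_left]
  ring

lemma continuousOn_jumpSol (ha : -1 < a) (ha0 : a < 0) (hW : LeftGrowth W) (k : ℕ) :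
    ContinuousOn (jumpSol a W k) (Set.Icc (-1) 0) := by
  obtain ⟨K, ρ, -, hρ0, hρ1, h⟩ := exists_abs_jumpSol_term_le ha ha0 hW
  have hs := summable_add_two_mul_pow (ρ := ρ) (by rwa [abs_of_pos hρ0])
  have hr := continuous_rExt a
  exact continuousOn_tsum (fun i => Continuous.continuousOn (by fun_prop))
    (hs.mul_left (K * (k + 2))) (fun i x hx => h k i x hx.1)

/-- The term `i = 0` drops out because `rExt` is constant up to time `1`. The term `i + 1` for `k`
satisfies the delay equation with the term `i` for `k + 1` as its delayed value. -/
lemma jumpSol_sub (ha : -1 < a) (ha0 : a < 0) (hW : LeftGrowth W) (k : ℕ) {x : ℝ}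
    (hx : x ∈ Set.Icc (-1 : ℝ) 0) :
    jumpSol a W k x - jumpSol a W k (-1) = a * ∫ v in (-1 : ℝ)..x, jumpSol a W (k + 1) v := by
  have hr := continuous_rExt a
  have hs1 := summable_jumpSol ha ha0 hW k hx.1
  have hs2 := summable_jumpSol ha ha0 hW k (le_refl (-1 : ℝ))
  obtain ⟨K, ρ, -, hρ0, hρ1, h⟩ := exists_abs_jumpSol_term_le ha ha0 hW
  have hs := summable_add_two_mul_pow (ρ := ρ) (by rwa [abs_of_pos hρ0])
  have hint := hasSum_integral_of_abs_le
    (f := fun i v => segSol a W (k + 1 + 1 + i) 0 * rExt a (v + 1 + i)) (fun i => by fun_prop)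
    (hs.mul_left (K * ((k + 1 : ℕ) + 2))) (fun i x hx => h (k + 1) i x hx.1) hx
  rw [jumpSol, jumpSol, ← hs1.tsum_sub hs2, (hs1.sub hs2).tsum_eq_zero_add]
  rw [Nat.cast_zero, rExt_of_le_one a (s := x + 1 + 0) (by linarith [hx.2]),
    rExt_of_le_one a (s := -1 + 1 + 0) (by norm_num), sub_self, zero_add]
  refine Eq.trans ?_ (hint.mul_left a).tsum_eq
  refine tsum_congr fun i => ?_
  have hi : (0 : ℝ) ≤ i := i.cast_nonneg
  rw [intervalIntegral.integral_const_mul, ← mul_sub,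
    rExt_sub a (by push_cast; linarith) (by push_cast; linarith [hx.1]),
    show k + 1 + (i + 1) = k + 1 + 1 + i by omega]
  have hsub := intervalIntegral.integral_comp_add_right (a := -1) (b := x)
    (fun v => rExt a (v - 1)) ((i : ℝ) + 2)
  rw [show (-1 : ℝ) + 1 + ((i + 1 : ℕ) : ℝ) = -1 + (i + 2) by push_cast; ring,
    show x + 1 + ((i + 1 : ℕ) : ℝ) = x + (i + 2) by push_cast; ring, ← hsub]
  have : ∀ v : ℝ, v + ((i : ℝ) + 2) - 1 = v + 1 + i := fun v => by ring
  simp_rw [this]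
  ring

/-- Indices below `k` vanish since `r` is zero at negative times, index `k` contributes only at `x =
0` through `r(0) = 1`, and the later indices form `jumpSol`. -/
lemma q_eq (ha : -1 < a) (ha0 : a < 0) (hW : LeftGrowth W) (k : ℕ) {x : ℝ}
    (hx : x ∈ Set.Icc (-1 : ℝ) 0) :
    q a W (x - k) = (if x = 0 then segSol a W k 0 else 0) + jumpSol a W k x := by
  have ha1 : |a| < 1 := abs_lt.2 ⟨ha, by linarith⟩
  have hJ : ∀ i : ℕ, p a W i 0 - W (-(i : ℝ) - 1) + W (-(i : ℝ)) = segSol a W i 0 := by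
    intro i
    rw [segSol_eq_p_add ha1 hW i (by simp), segInc, zero_sub]
    ring
  have htail : ∀ i : ℕ, segSol a W (i + (k + 1)) 0 * r a (x - k + (i + (k + 1) : ℕ))
      = segSol a W (k + 1 + i) 0 * rExt a (x + 1 + i) := by
    intro i
    have hi : (0 : ℝ) ≤ i := i.cast_nonneg
    rw [rExt_of_nonneg a (by linarith [hx.1]), add_comm i (k + 1)]
    congr 2
    push_cast
    ring
  have hsum : Summable fun i : ℕ => segSol a W i 0 * r a (x - k + i) := by
    rw [← summable_nat_add_iff (k + 1)]
    exact (summable_jumpSol ha ha0 hW k hx.1).congr fun i => (htail i).symm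
  unfold q
  simp_rw [hJ]
  rw [← hsum.sum_add_tsum_nat_add (k + 1), jumpSol]
  congr 1
  · rw [Finset.sum_range_succ, Finset.sum_eq_zero, zero_add, sub_add_cancel]
    · split_ifs with h
      · rw [h, ← rExt_of_nonneg a le_rfl, rExt_of_le_one a zero_le_one, mul_one]
      · rw [r, if_pos (lt_of_le_of_ne hx.2 h), mul_zero]
    · intro i hi
      have : ((i : ℕ) : ℝ) + 1 ≤ k := by exact_mod_cast Finset.mem_range.1 hi
      rw [r, if_pos (by linarith [hx.2]), mul_zero]
  · exact tsum_congr htail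

/-- At `x = 0` the only possible active indicator is that of `k - 1`, at its left endpoint, where
`segSol` vanishes; the missing value `segSol a W k 0` is supplied by `q`. The formula therefore
holds on the closed interval, which is what makes the pieces fit together continuously. -/
lemma leftPath_eq (ha : -1 < a) (ha0 : a < 0) (hW : LeftGrowth W) (k : ℕ) {x : ℝ}
    (hx : x ∈ Set.Icc (-1 : ℝ) 0) :
    leftPath a W (x - k) = segSol a W k x + jumpSol a W k x := by
  have ha1 : |a| < 1 := abs_lt.2 ⟨ha, by linarith⟩
  rw [leftPath, q_eq ha ha0 hW k hx, ← add_assoc]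
  congr 1
  have hval : ∀ i : ℕ, ∀ v : ℝ, v + i ∈ Set.Icc (-1 : ℝ) 0 →
      p a W i (v + i) - W (-(i : ℝ) - 1) + W v = segSol a W i (v + i) := by
    intro i v hv
    rw [segSol_eq_p_add ha1 hW i hv, segInc, add_sub_cancel_right]
    ring
  rcases hx.2.lt_or_eq with h | rfl
  · have hm : x - k ∈ Set.Ico (-(k : ℝ) - 1) (-(k : ℝ)) := ⟨by linarith [hx.1], by linarith⟩
    rw [if_neg h.ne, add_zero, tsum_eq_single k]
    · rw [Set.indicator_of_mem hm, hval k (x - k) (by simpa using hx),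
        sub_add_cancel]
    · intro i hi
      refine Set.indicator_of_notMem (fun hm => hi ?_) _
      have h1 : ((k : ℝ)) < i + 1 + 1 - 1 + 0 := by linarith [hm.1]
      have h2 : ((i : ℝ)) < k + 1 := by linarith [hm.2, hx.1]
      have h1' : k < i + 1 := by exact_mod_cast (by linarith : (k : ℝ) < i + 1)
      have h2' : i < k + 1 := by exact_mod_cast h2
      omega
  · rw [if_pos rfl, tsum_congr (g := fun _ => 0), tsum_zero, zero_add]
    intro i
    by_cases hm : (0 : ℝ) - k ∈ Set.Ico (-(i : ℝ) - 1) (-(i : ℝ))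
    · have h1 : i < k := by exact_mod_cast (by linarith [hm.2] : (i : ℝ) < k)
      have h2 : k ≤ i + 1 := by exact_mod_cast (by linarith [hm.1] : (k : ℝ) ≤ i + 1)
      have hk : (0 : ℝ) - k + i = -1 := by
        rw [show k = i + 1 by omega]
        push_cast
        ring
      rw [Set.indicator_of_mem hm, hval i _ (by rw [hk]; simp), hk, segSol_neg_one ha1 hW]
    · exact Set.indicator_of_notMem hm _

end Left

/-! ### The solution on the whole line -/

lemma continuous_of_continuousOn_Icc {y : ℝ → ℝ}
    (h : ∀ n : ℤ, ContinuousOn y (Set.Icc (n : ℝ) (n + 1))) : Continuous y := by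
  rw [continuous_iff_continuousAt]
  intro s
  rw [continuousAt_iff_continuous_left_right]
  constructor
  · have h1 : ((⌈s⌉ - 1 : ℤ) : ℝ) < s := by
      push_cast
      linarith [Int.ceil_lt_add_one s]
    have h2 : s ≤ ((⌈s⌉ - 1 : ℤ) : ℝ) + 1 := by
      push_cast
      linarith [Int.le_ceil s]
    exact (h _ s ⟨h1.le, h2⟩).mono_of_mem_nhdsWithin
      (mem_of_superset (Icc_mem_nhdsLE h1) (Set.Icc_subset_Icc_right h2))
  · have h1 : ((⌊s⌋ : ℤ) : ℝ) ≤ s := Int.floor_le s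
    have h2 : s < ((⌊s⌋ : ℤ) : ℝ) + 1 := Int.lt_floor_add_one s
    exact (h _ s ⟨h1, h2.le⟩).mono_of_mem_nhdsWithin
      (mem_of_superset (Icc_mem_nhdsGE h2) (Set.Icc_subset_Icc_left h1))

/-- The defect `F = y - a ∫ y(· - 1) - w` is constant on each closed unit interval, and neighbouring
intervals share an endpoint. -/
lemma delay_eq_of_unit_steps {a : ℝ} {w y : ℝ → ℝ} (hy : Continuous y)
    (h : ∀ n : ℤ, ∀ s ∈ Set.Icc (n : ℝ) (n + 1),
      y s - y n = a * (∫ v in (n : ℝ)..s, y (v - 1)) + (w s - w n)) (u s : ℝ) :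
    y s - y u = a * (∫ v in u..s, y (v - 1)) + (w s - w u) := by
  have hi : ∀ u s : ℝ, IntervalIntegrable (fun v => y (v - 1)) volume u s := fun u s =>
    (hy.comp (continuous_id.sub continuous_const)).intervalIntegrable u s
  set F : ℝ → ℝ := fun s => y s - a * (∫ v in (0 : ℝ)..s, y (v - 1)) - w s with hF
  have hstep : ∀ n : ℤ, ∀ s ∈ Set.Icc (n : ℝ) (n + 1), F s = F n := by
    intro n s hs
    have h1 := h n s hs
    rw [← intervalIntegral.integral_interval_sub_left (hi 0 s) (hi 0 n)] at h1
    simp only [hF]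
    linarith
  have hint : ∀ n : ℤ, F n = F 0 := by
    intro n
    induction n using Int.induction_on with
    | zero => simp
    | succ i ih =>
      rw [← ih]
      push_cast
      exact hstep (i : ℤ) _ (by simp)
    | pred i ih =>
      rw [← ih]
      symm
      have := hstep (-(i : ℤ) - 1) (-(i : ℤ) : ℤ) (by simp)
      exact this
  have hall : ∀ s, F s = F 0 := fun s => by
    rw [hstep ⌊s⌋ s ⟨Int.floor_le s, (Int.lt_floor_add_one s).le⟩, hint]
  have h1 := (hall s).trans (hall u).symm
  rw [← intervalIntegral.integral_interval_sub_left (hi 0 s) (hi 0 u)]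
  simp only [hF] at h1
  linarith

lemma stepPath_eq_baseProcess (a : ℝ) (W : C(ℝ, ℝ)) (n : ℕ) :
    ∀ s ≤ (n : ℝ), stepPath a W n s = baseProcess a W s := by
  induction n with
  | zero =>
    intro s hs
    rw [baseProcess, Nat.ceil_eq_zero.2 (by simpa using hs)]
  | succ n ih =>
    intro s hs
    rcases le_or_gt s n with h | h
    · simp only [stepPath]
      rw [if_pos h, ih s h]
    · rw [baseProcess, (Nat.ceil_eq_iff n.succ_ne_zero).2 ⟨by simpa using h, hs⟩]

lemma baseProcess_step (a : ℝ) (W : C(ℝ, ℝ)) (n : ℕ) {s : ℝ}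
    (hs : s ∈ Set.Icc (n : ℝ) (n + 1)) :
    baseProcess a W s - baseProcess a W n
      = a * (∫ v in (n : ℝ)..s, baseProcess a W (v - 1)) + (W s - W n) := by
  rcases hs.1.eq_or_lt with rfl | h
  · simp
  · have hI : ∫ v in (n : ℝ)..s, stepPath a W n (v - 1)
        = ∫ v in (n : ℝ)..s, baseProcess a W (v - 1) := by
      refine intervalIntegral.integral_congr fun v hv => ?_
      rw [Set.uIcc_of_le hs.1] at hv
      exact stepPath_eq_baseProcess a W n _ (by linarith [hv.2, hs.2])
    rw [← stepPath_eq_baseProcess a W (n + 1) s (by simpa using hs.2)]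
    simp only [stepPath]
    rw [if_neg (not_le.2 h), stepPath_eq_baseProcess a W n n le_rfl, hI]
    ring

lemma baseProcess_of_nonpos (a : ℝ) (W : C(ℝ, ℝ)) {s : ℝ} (hs : s ≤ 0) :
    baseProcess a W s = leftPath a W s := by
  rw [← stepPath_eq_baseProcess a W 0 s (by simpa using hs), stepPath]

section Solution

variable {a : ℝ} {W : C(ℝ, ℝ)}

lemma baseProcess_left (ha : -1 < a) (ha0 : a < 0) (hW : LeftGrowth W) (k : ℕ) {x : ℝ}
    (hx : x ∈ Set.Icc (-1 : ℝ) 0) :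
    baseProcess a W (x - k) = segSol a W k x + jumpSol a W k x := by
  have hk : (0 : ℝ) ≤ k := k.cast_nonneg
  rw [baseProcess_of_nonpos a W (by linarith [hx.2]), leftPath_eq ha ha0 hW k hx]

lemma continuousOn_baseProcess_left (ha : -1 < a) (ha0 : a < 0) (hW : LeftGrowth W) (k : ℕ) :
    ContinuousOn (baseProcess a W) (Set.Icc (-(k : ℝ) - 1) (-(k : ℝ))) := by
  have ha1 : |a| < 1 := abs_lt.2 ⟨ha, by linarith⟩
  have h := (continuousOn_segSol ha1 hW k).add (continuousOn_jumpSol ha ha0 hW k)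
  have h2 : ContinuousOn (fun s : ℝ => (segSol a W k + jumpSol a W k) (s + k))
      (Set.Icc (-(k : ℝ) - 1) (-(k : ℝ))) :=
    h.comp (by fun_prop) fun s hs => ⟨by linarith [hs.1], by linarith [hs.2]⟩
  refine h2.congr fun s hs => ?_
  dsimp only
  rw [Pi.add_apply, ← baseProcess_left ha ha0 hW k ⟨by linarith [hs.1], by linarith [hs.2]⟩,
    add_sub_cancel_right]

lemma baseProcess_step_left (ha : -1 < a) (ha0 : a < 0) (hW : LeftGrowth W) (k : ℕ) {x : ℝ}
    (hx : x ∈ Set.Icc (-1 : ℝ) 0) :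
    baseProcess a W (x - k) - baseProcess a W (-1 - k)
      = a * (∫ v in (-1 - k : ℝ)..(x - k), baseProcess a W (v - 1)) + (W (x - k) - W (-1 - k)) := by
  have ha1 : |a| < 1 := abs_lt.2 ⟨ha, by linarith⟩
  have hI : ∫ v in (-1 - k : ℝ)..(x - k), baseProcess a W (v - 1)
      = ∫ v in (-1 : ℝ)..x, (segSol a W (k + 1) v + jumpSol a W (k + 1) v) := by
    rw [← intervalIntegral.integral_comp_sub_right (fun v => baseProcess a W (v - 1)) (k : ℝ)]
    refine intervalIntegral.integral_congr fun v hv => ?_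
    rw [Set.uIcc_of_le hx.1] at hv
    rw [← baseProcess_left ha ha0 hW (k + 1) ⟨hv.1, hv.2.trans hx.2⟩]
    congr 1
    push_cast
    ring
  have hsub : Set.uIcc (-1 : ℝ) x ⊆ Set.Icc (-1) 0 := by
    rw [Set.uIcc_of_le hx.1]
    exact Set.Icc_subset_Icc_right hx.2
  rw [hI, intervalIntegral.integral_add
    ((continuousOn_segSol ha1 hW _).mono hsub).intervalIntegrable
    ((continuousOn_jumpSol ha ha0 hW _).mono hsub).intervalIntegrable,
    baseProcess_left ha ha0 hW k hx, baseProcess_left ha ha0 hW k (by simp),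
    segSol_neg_one ha1 hW, segSol_eq ha1 hW k hx, mul_add, ← jumpSol_sub ha ha0 hW k hx, segInc,
    show (-(k : ℝ) - 1) = -1 - k by ring]
  ring

lemma continuousOn_baseProcess_right (ha : -1 < a) (ha0 : a < 0) (hW : LeftGrowth W) (n : ℕ) :
    ContinuousOn (baseProcess a W) (Set.Icc ((n : ℝ) - 1) n) := by
  induction n with
  | zero => simpa using continuousOn_baseProcess_left ha ha0 hW 0
  | succ n ih =>
    have hle : (n : ℝ) ≤ n + 1 := by linarith
    push_cast
    rw [add_sub_cancel_right]
    have hc : ContinuousOn (fun v => baseProcess a W (v - 1)) (Set.uIcc (n : ℝ) (n + 1)) := by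
      rw [Set.uIcc_of_le hle]
      exact ih.comp (by fun_prop) fun v hv => ⟨by linarith [hv.1], by linarith [hv.2]⟩
    have hp := intervalIntegral.continuousOn_primitive_interval'
      (hc.intervalIntegrable (μ := volume)) Set.left_mem_uIcc
    rw [Set.uIcc_of_le hle] at hp
    have hfull : ContinuousOn (fun s => baseProcess a W n +
        (a * (∫ v in (n : ℝ)..s, baseProcess a W (v - 1)) + (W s - W n)))
        (Set.Icc (n : ℝ) (n + 1)) :=
      continuousOn_const.add ((continuousOn_const.mul hp).add
        (W.continuous.continuousOn.sub continuousOn_const))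
    refine hfull.congr fun s hs => ?_
    dsimp only
    rw [← baseProcess_step a W n hs]
    ring

lemma continuous_baseProcess (ha : -1 < a) (ha0 : a < 0) (hW : LeftGrowth W) :
    Continuous (baseProcess a W) := by
  refine continuous_of_continuousOn_Icc fun n => ?_
  rcases le_or_gt 0 n with h | h
  · lift n to ℕ using h
    simpa using continuousOn_baseProcess_right ha ha0 hW (n + 1)
  · obtain ⟨k, rfl⟩ : ∃ k : ℕ, n = -(k : ℤ) - 1 := ⟨(-n - 1).toNat, by omega⟩
    simpa using continuousOn_baseProcess_left ha ha0 hW k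

lemma baseProcess_sub (ha : -1 < a) (ha0 : a < 0) (hW : LeftGrowth W) (u s : ℝ) :
    baseProcess a W s - baseProcess a W u
      = a * (∫ v in u..s, baseProcess a W (v - 1)) + (W s - W u) := by
  refine delay_eq_of_unit_steps (continuous_baseProcess ha ha0 hW) (fun n s hs => ?_) u s
  rcases le_or_gt 0 n with h | h
  · lift n to ℕ using h
    exact baseProcess_step a W n (by simpa using hs)
  · obtain ⟨k, rfl⟩ : ∃ k : ℕ, n = -(k : ℤ) - 1 := ⟨(-n - 1).toNat, by omega⟩
    push_cast at hs ⊢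
    have := baseProcess_step_left ha ha0 hW k (x := s + k)
      ⟨by linarith [hs.1], by linarith [hs.2]⟩
    rwa [add_sub_cancel_right, show (-1 - k : ℝ) = -k - 1 by ring] at this

lemma leftGrowth_baseProcess (ha : -1 < a) (ha0 : a < 0) (hW : LeftGrowth W) :
    LeftGrowth (baseProcess a W) := by
  have ha1 : |a| < 1 := abs_lt.2 ⟨ha, by linarith⟩
  obtain ⟨K, hK0, hK⟩ := exists_abs_segSol_le ha1 hW
  obtain ⟨L, hL0, hL⟩ := exists_abs_jumpSol_le ha ha0 hW
  refine ⟨2 * (K + L), fun s hs => ?_⟩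
  set k := ⌊-s⌋₊ with hk
  have h1 : (k : ℝ) ≤ -s := Nat.floor_le (by linarith)
  have h2 : -s < k + 1 := Nat.lt_floor_add_one _
  have hx : s + k ∈ Set.Icc (-1 : ℝ) 0 := ⟨by linarith, by linarith⟩
  have h3 := baseProcess_left ha ha0 hW k hx
  rw [add_sub_cancel_right] at h3
  rw [h3]
  refine (abs_add_le _ _).trans ((add_le_add (hK k _ hx) (hL k _ hx)).trans ?_)
  nlinarith

end Solution

/-! ### Stability of linear growth, and uniqueness of the solution -/

lemma LeftGrowth.add {x y : ℝ → ℝ} (hx : LeftGrowth x) (hy : LeftGrowth y) :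
    LeftGrowth fun s => x s + y s := by
  obtain ⟨C, hC⟩ := hx
  obtain ⟨D, hD⟩ := hy
  exact ⟨C + D, fun s hs => (abs_add_le _ _).trans
    ((add_le_add (hC s hs) (hD s hs)).trans_eq (by ring))⟩

lemma LeftGrowth.neg {x : ℝ → ℝ} (hx : LeftGrowth x) : LeftGrowth fun s => -x s := by
  obtain ⟨C, hC⟩ := hx
  exact ⟨C, fun s hs => by simpa using hC s hs⟩

lemma LeftGrowth.sub {x y : ℝ → ℝ} (hx : LeftGrowth x) (hy : LeftGrowth y) :
    LeftGrowth fun s => x s - y s := by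
  simpa [sub_eq_add_neg] using hx.add hy.neg

lemma leftGrowth_const (c : ℝ) : LeftGrowth fun _ => c :=
  ⟨|c|, fun s hs => le_mul_of_one_le_right (abs_nonneg c) (by linarith)⟩

lemma LeftGrowth.comp_add {x : ℝ → ℝ} (hx : LeftGrowth x) (hc : Continuous x) (u : ℝ) :
    LeftGrowth fun s => x (s + u) := by
  obtain ⟨C, hC⟩ := hx
  have hC0 : 0 ≤ C := by simpa using (abs_nonneg _).trans (hC 0 le_rfl)
  obtain ⟨B, hB⟩ := (isCompact_Icc (a := 0) (b := u)).exists_bound_of_continuousOn hc.continuousOn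
  refine ⟨C * (1 + |u|) + |B|, fun s hs => ?_⟩
  have hm : 0 ≤ C * |u| := mul_nonneg hC0 (abs_nonneg u)
  rcases le_total (s + u) 0 with h | h
  · refine (hC _ h).trans ?_
    have h1 : C * (1 - (s + u)) ≤ C * ((1 + |u|) * (1 - s)) := by
      refine mul_le_mul_of_nonneg_left ?_ hC0
      nlinarith [neg_abs_le u, mul_nonneg (abs_nonneg u) (neg_nonneg.2 hs)]
    have h2 : 0 ≤ |B| * (1 - s) := mul_nonneg (abs_nonneg B) (by linarith)
    linarith
  · refine (hB _ ⟨h, by linarith⟩).trans ((le_abs_self B).trans ?_)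
    have h2 : 0 ≤ |B| * (-s) := mul_nonneg (abs_nonneg B) (by linarith)
    have h1 : 0 ≤ C * (1 + |u|) * (1 - s) :=
      mul_nonneg (mul_nonneg hC0 (by positivity)) (by linarith)
    linarith

/-- Two solutions of the delay equation of linear growth at `-∞` whose driving paths have the same
increments coincide. -/
lemma eq_of_delay {a : ℝ} (ha : -1 < a) (ha0 : a < 0) {w₁ w₂ y₁ y₂ : ℝ → ℝ} (h₁ : Continuous y₁)
    (h₂ : Continuous y₂)
    (e₁ : ∀ u s, y₁ s - y₁ u = a * (∫ v in u..s, y₁ (v - 1)) + (w₁ s - w₁ u))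
    (e₂ : ∀ u s, y₂ s - y₂ u = a * (∫ v in u..s, y₂ (v - 1)) + (w₂ s - w₂ u))
    (g₁ : LeftGrowth y₁) (g₂ : LeftGrowth y₂) (hw : ∀ u s, w₁ s - w₁ u = w₂ s - w₂ u) :
    y₁ = y₂ := by
  have hi : ∀ {y : ℝ → ℝ}, Continuous y → ∀ u s : ℝ,
      IntervalIntegrable (fun v => y (v - 1)) volume u s := fun hy u s =>
    (hy.comp (continuous_id.sub continuous_const)).intervalIntegrable u s
  have := eq_zero_of_delay ha ha0 (h₁.sub h₂) (fun u v => ?_) (g₁.sub g₂)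
  · exact funext fun s => sub_eq_zero.1 (this s)
  · simp only [Pi.sub_apply]
    rw [intervalIntegral.integral_sub (hi h₁ u v) (hi h₂ u v)]
    linarith [e₁ u v, e₂ u v, hw u v]

/-! ### Random paths -/

lemma measurable_eval (s : ℝ) : Measurable fun W : C(ℝ, ℝ) => W s :=
  (continuous_eval_const s).measurable

/-- Restriction to the rationals is measurable and injective on a standard Borel space, hence a
measurable embedding by Lusin–Souslin, and `g` is a measurable left inverse. Measurability,
independence and laws of random paths thereby reduce to coordinates. -/
lemma exists_measurable_path_of_rat :
    ∃ g : (ℚ → ℝ) → C(ℝ, ℝ), Measurable g ∧ ∀ x : C(ℝ, ℝ), g (fun t => x t) = x := by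
  have hm : Measurable fun (x : C(ℝ, ℝ)) (t : ℚ) => x t :=
    measurable_pi_lambda _ fun t => measurable_eval t
  have hinj : Function.Injective fun (x : C(ℝ, ℝ)) (t : ℚ) => x t := by
    intro x y hxy
    refine ContinuousMap.ext fun s => ?_
    have := Rat.denseRange_cast.equalizer x.continuous y.continuous (funext fun t => congrFun hxy t)
    exact congrFun this s
  obtain ⟨g, hg, hgc⟩ := (hm.measurableEmbedding hinj).exists_measurable_extend
    measurable_id (fun _ => ⟨0⟩)
  exact ⟨g, hg, fun x => congrFun hgc x⟩

lemma measurable_path {α : Type*} [MeasurableSpace α] {f : α → C(ℝ, ℝ)}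
    (hf : ∀ s, Measurable fun x => f x s) : Measurable f := by
  obtain ⟨g, hg, hgc⟩ := exists_measurable_path_of_rat
  have : f = g ∘ fun x (t : ℚ) => f x t := funext fun x => (hgc (f x)).symm
  rw [this]
  exact hg.comp (measurable_pi_lambda _ fun t => hf t)

lemma exists_measurable_path_of_fun :
    ∃ g : (ℝ → ℝ) → C(ℝ, ℝ), Measurable g ∧ ∀ x : C(ℝ, ℝ), g (fun t => x t) = x := by
  obtain ⟨g, hg, hgc⟩ := exists_measurable_path_of_rat
  exact ⟨fun x => g fun t => x t, hg.comp (measurable_pi_lambda _ fun t => measurable_pi_apply _),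
    fun x => hgc x⟩

lemma map_path_eq {Ω : Type*} [MeasurableSpace Ω] {P : Measure Ω} {X Y : Ω → C(ℝ, ℝ)}
    (hX : Measurable X) (hY : Measurable Y)
    (h : P.map (fun ω s => X ω s) = P.map (fun ω s => Y ω s)) : P.map X = P.map Y := by
  obtain ⟨g, hg, hgc⟩ := exists_measurable_path_of_fun
  have key : ∀ {Z : Ω → C(ℝ, ℝ)}, Measurable Z → P.map Z = (P.map fun ω s => Z ω s).map g := by
    intro Z hZ
    have hZ' : Measurable fun ω s => Z ω s :=
      measurable_pi_lambda _ fun s => (measurable_eval s).comp hZ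
    rw [Measure.map_map hg hZ']
    congr 1
    exact funext fun ω => (hgc (Z ω)).symm
  rw [key hX, key hY, h]

lemma measurable_timeReverse : Measurable timeReverse :=
  measurable_path fun s => measurable_eval (-s)

/-- The path started at `0` with the increments of `x`. -/
def incr (x : C(ℝ, ℝ)) : C(ℝ, ℝ) := x - ContinuousMap.const ℝ (x 0)

@[simp] lemma incr_apply (x : C(ℝ, ℝ)) (s : ℝ) : incr x s = x s - x 0 := rfl

lemma measurable_incr : Measurable incr :=
  measurable_path fun s => (measurable_eval s).sub (measurable_eval 0)

lemma IsTwoSidedBrownian.indepFun_incr {ν : Measure ℝ} {Q : Measure C(ℝ, ℝ)}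
    (hQ : IsTwoSidedBrownian ν Q) : IndepFun (fun W : C(ℝ, ℝ) => W 0) incr Q := by
  obtain ⟨g, hg, hgc⟩ := exists_measurable_path_of_fun
  have := hQ.indep_initial.comp measurable_id hg
  have h : incr = g ∘ fun (W : C(ℝ, ℝ)) s => W s - W 0 := funext fun W => (hgc (incr W)).symm
  rw [h]
  exact this

/-! ### Growth of Brownian paths -/

/-- By time inversion `t B(1/t)` has the same law as `B`, whose paths are bounded near `0`.
Boundedness of `t B(1/t)` near `0` is linear growth of `B` at infinity. -/
lemma IsTwoSidedBrownian.ae_leftGrowth {ν : Measure ℝ} {Q : Measure C(ℝ, ℝ)}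
    [IsProbabilityMeasure Q] (hQ : IsTwoSidedBrownian ν Q) :
    ∀ᵐ W ∂Q, LeftGrowth (W : C(ℝ, ℝ)) := by
  set B : ℝ≥0 → C(ℝ, ℝ) → ℝ := fun s W => W (-(s : ℝ)) - W 0 with hB
  have hpre : IsPreBrownianReal B Q := hQ.backward.toIsPreBrownianReal
  have hBm : ∀ t, Measurable (B t) := fun t => (measurable_eval _).sub (measurable_eval 0)
  have hm1 : Measurable fun (W : C(ℝ, ℝ)) t => B t W := measurable_pi_lambda _ hBm
  have hm2 : Measurable fun (W : C(ℝ, ℝ)) (t : ℝ≥0) => (t : ℝ) * B (1 / t) W :=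
    measurable_pi_lambda _ fun t => (hBm _).const_mul _
  have hlaw : Q.map (fun W t => B t W) = Q.map (fun W (t : ℝ≥0) => (t : ℝ) * B (1 / t) W) := by
    rw [map_eq_iff_forall_finset_map_restrict_eq (X := B)
      (Y := fun (t : ℝ≥0) W => (t : ℝ) * B (1 / t) W) hm1.aemeasurable hm2.aemeasurable]
    intro I
    rw [(hpre.hasLaw I).map_eq, (hpre.inv.hasLaw I).map_eq]
  -- Only rational times appear, so that `A` is measurable in the uncountable product. The range up
  -- to `2` puts every `1 / -s` with `s ≤ -1` inside the open interval `(0, 2)`, where continuity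
  -- passes from rational to real times.
  set A : Set (ℝ≥0 → ℝ) := {x | ∃ C : ℕ, ∀ t : ℚ, (t : ℝ) ≤ 2 → |x (Real.toNNReal t)| ≤ C} with hA
  have hAm : MeasurableSet A := by
    simp only [hA, Set.ofPred_exists, Set.ofPred_forall]
    refine MeasurableSet.iUnion fun C => MeasurableSet.iInter fun t => MeasurableSet.iInter fun _ =>
      measurableSet_le ?_ measurable_const
    exact (measurable_pi_apply _).abs
  have h1 : A ∈ ae (Q.map fun W t => B t W) := by
    rw [mem_ae_map_iff hm1.aemeasurable hAm]
    refine univ_mem' fun W => ?_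
    obtain ⟨C, hC⟩ := (isCompact_Icc (a := (-2 : ℝ)) (b := 0)).exists_bound_of_continuousOn
      (f := fun s => W s - W 0) (by fun_prop)
    obtain ⟨n, hn⟩ := exists_nat_ge C
    refine ⟨n, fun t ht => (hC _ ⟨?_, ?_⟩).trans hn⟩
    · rw [Real.coe_toNNReal']
      have := max_le ht zero_le_two
      linarith
    · simp
  rw [hlaw, mem_ae_map_iff hm2.aemeasurable hAm] at h1
  filter_upwards [h1] with W hW
  obtain ⟨C, hC⟩ := hW
  have hdense : ∀ s : ℝ, 0 < s → s < 2 → s * |W (-(1 / s)) - W 0| ≤ C := by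
    intro s hs0 hs2
    by_contra! hlt
    have hcont : ContinuousOn (fun s : ℝ => s * |W (-(1 / s)) - W 0|) (Set.Ioo 0 2) := by
      refine continuousOn_id.mul (ContinuousOn.abs (ContinuousOn.sub ?_ continuousOn_const))
      refine W.continuous.comp_continuousOn (ContinuousOn.neg ?_)
      exact continuousOn_const.div continuousOn_id fun x hx => hx.1.ne'
    have hopen := hcont.isOpen_inter_preimage isOpen_Ioo (isOpen_Ioi (a := (C : ℝ)))
    obtain ⟨t, ht1, ht2⟩ := Rat.denseRange_cast.exists_mem_open hopen ⟨s, ⟨hs0, hs2⟩, hlt⟩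
    have h := hC t ht1.2.le
    simp only [hB] at h
    rw [NNReal.coe_div, NNReal.coe_one, Real.coe_toNNReal _ ht1.1.le, abs_mul,
      abs_of_pos ht1.1] at h
    exact absurd ht2 (not_lt.2 h)
  obtain ⟨D, hD⟩ := (isCompact_Icc (a := (-1 : ℝ)) (b := 0)).exists_bound_of_continuousOn
    W.continuous.continuousOn
  have hD0 : 0 ≤ D := (norm_nonneg _).trans (hD 0 (by simp))
  have hC0 : (0 : ℝ) ≤ C := C.cast_nonneg
  refine ⟨C + D, fun s hs => ?_⟩
  rcases le_total (-1) s with h | h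
  · refine (hD s ⟨h, hs⟩).trans ?_
    nlinarith
  · have hs0 : 0 < -s := by linarith
    have h2 := hdense (1 / -s) (by positivity) (by rw [div_lt_iff₀ hs0]; linarith)
    rw [one_div_one_div, neg_neg, one_div_mul_eq_div, div_le_iff₀ hs0] at h2
    have h3 := hD 0 (by simp)
    rw [Real.norm_eq_abs] at h3
    have h4 : |W s| ≤ |W s - W 0| + |W 0| := by
      simpa using abs_add_le (W s - W 0) (W 0)
    nlinarith

/-! ### The Gaussian process of increments -/

/-- Independent Gaussian vectors are jointly Gaussian, and a finite family of coordinates is a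
linear image of its left and right parts. -/
lemma isGaussianProcess_sumElim {S T Ω : Type*} [MeasurableSpace Ω] {P : Measure Ω}
    {X : S → Ω → ℝ} {Y : T → Ω → ℝ} (hX : IsGaussianProcess X P) (hY : IsGaussianProcess Y P)
    (h : IndepFun (fun ω s => X s ω) (fun ω t => Y t ω) P) :
    IsGaussianProcess (Sum.elim X Y) P where
  hasGaussianLaw I := by
    have hind := h.comp (Finset.measurable_restrict I.toLeft) (Finset.measurable_restrict I.toRight)
    have hG := hind.hasGaussianLaw (hX.hasGaussianLaw I.toLeft) (hY.hasGaussianLaw I.toRight)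
    let L : ((I.toLeft → ℝ) × (I.toRight → ℝ)) →L[ℝ] (I → ℝ) := ContinuousLinearMap.pi fun i =>
      match i with
      | ⟨Sum.inl s, hs⟩ => (ContinuousLinearMap.proj (R := ℝ) (φ := fun _ : I.toLeft => ℝ)
          ⟨s, Finset.mem_toLeft.2 hs⟩).comp (ContinuousLinearMap.fst ℝ _ _)
      | ⟨Sum.inr t, ht⟩ => (ContinuousLinearMap.proj (R := ℝ) (φ := fun _ : I.toRight => ℝ)
          ⟨t, Finset.mem_toRight.2 ht⟩).comp (ContinuousLinearMap.snd ℝ _ _)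
    have hL : (fun ω => I.restrict (Sum.elim X Y · ω))
        = L ∘ fun ω => (I.toLeft.restrict (X · ω), I.toRight.restrict (Y · ω)) := by
      funext ω i
      obtain ⟨s | t, hi⟩ := i <;> rfl
    rw [hL]
    exact hG.map L

/-- The law of a centered Gaussian process is determined by its covariance. -/
lemma map_eq_of_isGaussianProcess {T Ω : Type*} [MeasurableSpace Ω] {P : Measure Ω}
    {X Y : T → Ω → ℝ} (hX : IsGaussianProcess X P) (hY : IsGaussianProcess Y P)
    (mX : ∀ t, Measurable (X t)) (mY : ∀ t, Measurable (Y t))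
    (eX : ∀ t, P[X t] = 0) (eY : ∀ t, P[Y t] = 0)
    (hcov : ∀ s t, cov[X s, X t; P] = cov[Y s, Y t; P]) :
    P.map (fun ω t => X t ω) = P.map (fun ω t => Y t ω) := by
  have := hX.isProbabilityMeasure
  rw [map_eq_iff_forall_finset_map_restrict_eq (measurable_pi_lambda _ mX).aemeasurable
    (measurable_pi_lambda _ mY).aemeasurable]
  intro I
  have hXI := (hX.hasGaussianLaw I).isGaussian_map
  have hYI := (hY.hasGaussianLaw I).isGaussian_map
  have mXI : AEMeasurable (fun ω => I.restrict (X · ω)) P :=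
    (Finset.measurable_restrict I).comp_aemeasurable
      (measurable_pi_lambda _ mX).aemeasurable
  have mYI : AEMeasurable (fun ω => I.restrict (Y · ω)) P :=
    (Finset.measurable_restrict I).comp_aemeasurable
      (measurable_pi_lambda _ mY).aemeasurable
  -- `covarianceBilin` lives on an inner product space, so the comparison of means and covariances
  -- is carried out in Euclidean space.
  apply (MeasurableEquiv.toLp 2 (_ → ℝ)).map_measurableEquiv_injective
  rw [MeasurableEquiv.coe_toLp, ← PiLp.coe_symm_continuousLinearEquiv 2 ℝ]
  have hmean : ∀ {Z : T → Ω → ℝ}, IsGaussianProcess Z P →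
      AEMeasurable (fun ω => I.restrict (Z · ω)) P → (∀ t, P[Z t] = 0) →
      (((P.map fun ω => I.restrict (Z · ω)).map
        (PiLp.continuousLinearEquiv 2 ℝ fun _ : I => ℝ).symm)[id]) = 0 := by
    intro Z hZ mZ eZ
    rw [integral_map (by fun_prop) (by fun_prop), integral_map mZ (by fun_prop)]
    simp only [id_eq]
    rw [ContinuousLinearEquiv.integral_comp_comm]
    simp only [PiLp.continuousLinearEquiv_symm_apply, WithLp.toLp_eq_zero]
    ext i
    rw [eval_integral]
    · simpa using eZ _
    · exact fun _ => (hZ.hasGaussianLaw_eval _).integrable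
  apply IsGaussian.ext
  · rw [hmean hX mXI eX, hmean hY mYI eY]
  · rw [← ContinuousLinearMap.toBilinForm_inj]
    refine LinearMap.BilinForm.ext_of_isSymm isPosSemidef_covarianceBilin.isSymm
      isPosSemidef_covarianceBilin.isSymm fun x => ?_
    simp only [ContinuousLinearMap.toBilinForm_apply]
    rw [PiLp.coe_symm_continuousLinearEquiv, covarianceBilin_apply_pi, covarianceBilin_apply_pi]
    · congrm ∑ i, ∑ j, _ * ?_
      have me : ∀ (i : I) (μ : Measure (I → ℝ)), AEStronglyMeasurable (fun x => x i) μ :=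
        fun i μ => (measurable_pi_apply i).aestronglyMeasurable
      rw [covariance_map (me i _) (me j _) mXI, covariance_map (me i _) (me j _) mYI]
      exact hcov i j
    · exact fun i => (hYI.hasGaussianLaw_id.eval i).memLp_two
    · exact fun i => (hXI.hasGaussianLaw_id.eval i).memLp_two

section Increments

variable {ν : Measure ℝ} {Q : Measure C(ℝ, ℝ)}

lemma sub_zero_eq_add_toNNReal (W : C(ℝ, ℝ)) (s : ℝ) :
    W s - W 0 = (W (s.toNNReal : ℝ) - W 0) + (W (-((-s).toNNReal : ℝ)) - W 0) := by
  rcases le_total 0 s with h | h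
  · rw [Real.coe_toNNReal s h, Real.toNNReal_of_nonpos (by linarith : -s ≤ 0)]
    simp
  · rw [Real.coe_toNNReal (-s) (by linarith), Real.toNNReal_of_nonpos h]
    simp

lemma IsTwoSidedBrownian.isGaussianProcess_sub_zero (hQ : IsTwoSidedBrownian ν Q) :
    IsGaussianProcess (fun s (W : C(ℝ, ℝ)) => W s - W 0) Q := by
  have h := isGaussianProcess_sumElim hQ.forward.isGaussianProcess hQ.backward.isGaussianProcess
    hQ.indep_sides
  refine IsGaussianProcess.of_isGaussianProcess h fun s => ⟨{Sum.inl s.toNNReal, Sum.inr (-s).toNNReal},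
    ContinuousLinearMap.proj ⟨Sum.inl s.toNNReal, by simp⟩
      + ContinuousLinearMap.proj ⟨Sum.inr (-s).toNNReal, by simp⟩, fun W => ?_⟩
  exact sub_zero_eq_add_toNNReal W s

lemma IsTwoSidedBrownian.integral_sub_zero (hQ : IsTwoSidedBrownian ν Q) (s : ℝ) :
    Q[fun W : C(ℝ, ℝ) => W s - W 0] = 0 := by
  simp_rw [sub_zero_eq_add_toNNReal _ s]
  rw [integral_add (hQ.forward.integrable_eval _) (hQ.backward.integrable_eval _)]
  have h1 := hQ.forward.integral_eval s.toNNReal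
  have h2 := hQ.backward.integral_eval (-s).toNNReal
  rw [h1, h2, add_zero]

/-- This puts the covariance of the two-sided process into a form where stationarity of the
increments is visible. -/
lemma min_toNNReal_add_min (s u : ℝ) :
    ((min s.toNNReal u.toNNReal : ℝ≥0) : ℝ) + ((min (-s).toNNReal (-u).toNNReal : ℝ≥0) : ℝ)
      = (|s| + |u| - |s - u|) / 2 := by
  simp only [NNReal.coe_min, Real.coe_toNNReal']
  rcases abs_cases s with ⟨h1, _⟩ | ⟨h1, _⟩ <;> rcases abs_cases u with ⟨h2, _⟩ | ⟨h2, _⟩ <;>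
    rcases abs_cases (s - u) with ⟨h3, _⟩ | ⟨h3, _⟩ <;> rw [h1, h2, h3] <;> grind

lemma IsTwoSidedBrownian.covariance_sub_zero [IsProbabilityMeasure Q]
    (hQ : IsTwoSidedBrownian ν Q) (s u : ℝ) :
    cov[fun W : C(ℝ, ℝ) => W s - W 0, fun W => W u - W 0; Q] = (|s| + |u| - |s - u|) / 2 := by
  have mF : ∀ t : ℝ≥0, MemLp (fun W : C(ℝ, ℝ) => W (t : ℝ) - W 0) 2 Q := fun t =>
    (hQ.forward.isGaussianProcess.hasGaussianLaw_eval t).memLp_two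
  have mB : ∀ t : ℝ≥0, MemLp (fun W : C(ℝ, ℝ) => W (-(t : ℝ)) - W 0) 2 Q := fun t =>
    (hQ.backward.isGaussianProcess.hasGaussianLaw_eval t).memLp_two
  have hcross : ∀ t t' : ℝ≥0, cov[fun W : C(ℝ, ℝ) => W (t : ℝ) - W 0,
      fun W => W (-(t' : ℝ)) - W 0; Q] = 0 := fun t t' =>
    (hQ.indep_sides.comp (measurable_pi_apply t) (measurable_pi_apply t')).covariance_eq_zero
      (mF t) (mB t')
  have hFF := hQ.forward.covariance_fun_eval s.toNNReal u.toNNReal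
  have hBB := hQ.backward.covariance_fun_eval (-s).toNNReal (-u).toNNReal
  simp_rw [sub_zero_eq_add_toNNReal _ s, sub_zero_eq_add_toNNReal _ u]
  change cov[(fun W : C(ℝ, ℝ) => W (s.toNNReal : ℝ) - W 0)
      + fun W : C(ℝ, ℝ) => W (-((-s).toNNReal : ℝ)) - W 0,
    (fun W : C(ℝ, ℝ) => W (u.toNNReal : ℝ) - W 0)
      + fun W : C(ℝ, ℝ) => W (-((-u).toNNReal : ℝ)) - W 0; Q] = _
  rw [covariance_add_left (mF _) (mB _) ((mF _).add (mB _)),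
    covariance_add_right (mF _) (mF _) (mB _), covariance_add_right (mB _) (mF _) (mB _),
    hcross, covariance_comm (fun W : C(ℝ, ℝ) => W (-((-s).toNNReal : ℝ)) - W 0)
      (fun W : C(ℝ, ℝ) => W (u.toNNReal : ℝ) - W 0),
    hcross, ← min_toNNReal_add_min, hFF, hBB]
  ring

/-- The law of the increments of two-sided Brownian motion is invariant under time shifts. -/
lemma IsTwoSidedBrownian.map_incr_timeShift [IsProbabilityMeasure Q]
    (hQ : IsTwoSidedBrownian ν Q) (t : ℝ) :
    (Q.map incr).map (fun w => incr (timeShift t w)) = Q.map incr := by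
  have hs : Measurable fun w => incr (timeShift t w) :=
    measurable_incr.comp (measurable_timeShift t)
  have hG := hQ.isGaussianProcess_sub_zero
  have hm : ∀ s : ℝ, MemLp (fun W : C(ℝ, ℝ) => W s - W 0) 2 Q := fun s =>
    (hG.hasGaussianLaw_eval s).memLp_two
  rw [Measure.map_map hs measurable_incr]
  refine map_path_eq (hs.comp measurable_incr) measurable_incr ?_
  have hval : ∀ (W : C(ℝ, ℝ)) (s : ℝ),
      ((fun w => incr (timeShift t w)) ∘ incr) W s = (W (t + s) - W 0) - (W t - W 0) := by
    intro W s
    simp [timeShift, add_comm]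
  simp_rw [hval, incr_apply]
  -- Both families are centred Gaussian, so only covariances remain to be compared; in them the
  -- terms `|t|`, `|t + s|` and `|t + u|` cancel.
  refine map_eq_of_isGaussianProcess (hG.shift t) hG (fun s => ?_) (fun s => ?_) (fun s => ?_)
    hQ.integral_sub_zero fun s u => ?_
  · exact ((measurable_eval _).sub (measurable_eval 0)).sub
      ((measurable_eval _).sub (measurable_eval 0))
  · exact (measurable_eval _).sub (measurable_eval 0)
  · have h := integral_sub (μ := Q) ((hm (t + s)).integrable one_le_two)
      ((hm t).integrable one_le_two)
    rw [h, hQ.integral_sub_zero, hQ.integral_sub_zero, sub_zero]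
  · rw [covariance_fun_sub_fun_sub (hm _) (hm _) (hm _) (hm _)]
    simp_rw [hQ.covariance_sub_zero]
    rw [add_sub_add_left_eq_sub, add_sub_cancel_left, sub_self, abs_zero,
      show t - (t + u) = -u by ring, abs_neg]
    ring

/-- The time reversal of two-sided Brownian motion is a two-sided Brownian motion. -/
lemma IsTwoSidedBrownian.map_timeReverse [IsProbabilityMeasure Q] (hQ : IsTwoSidedBrownian ν Q) :
    IsTwoSidedBrownian ν (Q.map timeReverse) := by
  have hR := measurable_timeReverse
  have hB : ∀ {X : ℝ≥0 → C(ℝ, ℝ) → ℝ}, (∀ t, Measurable (X t)) →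
      (∀ W, Continuous fun t => X t W) →
      IsBrownianReal (fun t W => X t (timeReverse W)) Q → IsBrownianReal X (Q.map timeReverse) := by
    intro X hX hc hb
    refine ⟨⟨fun I => ⟨?_, ?_⟩⟩, .of_forall hc⟩
    · exact ((Finset.measurable_restrict I).comp (measurable_pi_lambda _ hX)).aemeasurable
    · have hm : Measurable fun ω => I.restrict (X · ω) :=
        (Finset.measurable_restrict I).comp (measurable_pi_lambda _ hX)
      rw [← (hb.hasLaw I).map_eq, Measure.map_map hm hR]
      rfl
  have h0 : ∀ W : C(ℝ, ℝ), timeReverse W 0 = W 0 := fun W => by simp [timeReverse]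
  have h1 : ∀ (W : C(ℝ, ℝ)) (s : ℝ), timeReverse W s = W (-s) := fun W s => rfl
  have hI : ∀ {α β : Type} [MeasurableSpace α] [MeasurableSpace β] {f : C(ℝ, ℝ) → α}
      {g : C(ℝ, ℝ) → β}, Measurable f → Measurable g →
      IndepFun (fun W => f (timeReverse W)) (fun W => g (timeReverse W)) Q →
      IndepFun f g (Q.map timeReverse) := by
    intro α β _ _ f g hf hg h
    rw [indepFun_iff_measure_inter_preimage_eq_mul] at h ⊢
    intro s t hs ht
    rw [Measure.map_apply hR ((hf hs).inter (hg ht)), Measure.map_apply hR (hf hs),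
      Measure.map_apply hR (hg ht)]
    exact h s t hs ht
  have mS : ∀ s : ℝ, Measurable fun W : C(ℝ, ℝ) => W s - W 0 := fun s =>
    (measurable_eval s).sub (measurable_eval 0)
  refine ⟨?_, ?_, ?_, ?_, ?_⟩
  · rw [Measure.map_map (measurable_eval 0) hR, ← hQ.initial]
    congr 1
    exact funext h0
  · refine hI (measurable_eval 0) (measurable_pi_lambda _ fun s => mS s) ?_
    simp_rw [h0, h1]
    exact hQ.indep_initial.comp measurable_id
      (measurable_pi_lambda (fun (x : ℝ → ℝ) s => x (-s)) fun s => measurable_pi_apply (-s))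
  · refine hB (fun t => mS _) (fun W => by fun_prop) ?_
    simpa only [h0, h1] using hQ.backward
  · refine hB (fun t => mS _) (fun W => by fun_prop) ?_
    simpa only [h0, h1, neg_neg] using hQ.forward
  · refine hI (measurable_pi_lambda _ fun s => mS s) (measurable_pi_lambda _ fun s => mS _) ?_
    simp_rw [h0, h1, neg_neg]
    exact hQ.indep_sides.symm

end Increments

/-! ### Measurability of the solution map -/

lemma measurableSet_leftGrowth : MeasurableSet {y : C(ℝ, ℝ) | LeftGrowth y} := by
  have : {y : C(ℝ, ℝ) | LeftGrowth y} = ⋃ C : ℕ, ⋂ s : ℝ, ⋂ _ : s ≤ 0, {y | |y s| ≤ C * (1 - s)} := by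
    ext y
    simp only [Set.mem_ofPred_eq, Set.mem_iUnion, Set.mem_iInter]
    constructor
    · rintro ⟨C, hC⟩
      obtain ⟨n, hn⟩ := exists_nat_ge C
      exact ⟨n, fun s hs => (hC s hs).trans (mul_le_mul_of_nonneg_right hn (by linarith))⟩
    · rintro ⟨C, hC⟩
      exact ⟨C, hC⟩
  rw [this]
  refine MeasurableSet.iUnion fun C => IsClosed.measurableSet ?_
  refine isClosed_iInter fun s => isClosed_iInter fun _ => ?_
  exact isClosed_le (continuous_eval_const s).abs continuous_const

/-- The path which drives the delay equation solved by `y`. -/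
noncomputable def driving (a : ℝ) (y : C(ℝ, ℝ)) : C(ℝ, ℝ) where
  toFun s := y s - y 0 - a * ∫ v in (0 : ℝ)..s, y (v - 1)
  continuous_toFun := by
    have : Continuous fun s => ∫ v in (0 : ℝ)..s, y (v - 1) :=
      intervalIntegral.continuous_primitive
        (fun u s => Continuous.intervalIntegrable (by fun_prop) u s) 0
    fun_prop

lemma driving_apply (a : ℝ) (y : C(ℝ, ℝ)) (s : ℝ) :
    driving a y s = y s - y 0 - a * ∫ v in (0 : ℝ)..s, y (v - 1) := rfl

lemma measurable_driving (a : ℝ) : Measurable (driving a) := by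
  refine measurable_path fun s => ?_
  simp only [driving_apply, intervalIntegral]
  have hc : Continuous fun p : C(ℝ, ℝ) × ℝ => p.1 (p.2 - 1) := by fun_prop
  have hi : ∀ A : Set ℝ, Measurable fun y : C(ℝ, ℝ) => ∫ v in A, y (v - 1) := fun A =>
    (hc.stronglyMeasurable.integral_prod_right' (ν := volume.restrict A)).measurable
  exact ((measurable_eval s).sub (measurable_eval 0)).sub (((hi _).sub (hi _)).const_mul a)

lemma sub_eq_of_driving (a : ℝ) (y : C(ℝ, ℝ)) (u s : ℝ) :
    y s - y u = a * (∫ v in u..s, y (v - 1)) + (driving a y s - driving a y u) := by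
  have hi : ∀ u s : ℝ, IntervalIntegrable (fun v => y (v - 1)) volume u s := fun u s =>
    Continuous.intervalIntegrable (by fun_prop) u s
  rw [driving_apply, driving_apply, ← intervalIntegral.integral_interval_sub_left (hi 0 s) (hi 0 u)]
  ring

/-- By the Lusin–Souslin theorem, the solution of linear growth at `-∞` is a Borel function of the
driving path. -/
lemma exists_measurable_solution {a : ℝ} (ha : -1 < a) (ha0 : a < 0) :
    ∃ g : C(ℝ, ℝ) → C(ℝ, ℝ), Measurable g ∧ ∀ y : C(ℝ, ℝ), LeftGrowth y → g (driving a y) = y := by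
  have := measurableSet_leftGrowth.standardBorel
  have hm : Measurable fun y : {y : C(ℝ, ℝ) | LeftGrowth y} => driving a y :=
    (measurable_driving a).comp measurable_subtype_coe
  have hinj : Function.Injective fun y : {y : C(ℝ, ℝ) | LeftGrowth y} => driving a y := by
    intro y₁ y₂ h
    refine Subtype.ext (DFunLike.coe_injective ?_)
    exact eq_of_delay ha ha0 y₁.1.continuous y₂.1.continuous (sub_eq_of_driving a y₁)
      (sub_eq_of_driving a y₂) y₁.2 y₂.2 fun u s => by
        have h' : driving a y₁ = driving a y₂ := h
        rw [h']
  obtain ⟨g, hg, hgc⟩ := (hm.measurableEmbedding hinj).exists_measurable_extend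
    measurable_subtype_coe (fun _ => ⟨0⟩)
  exact ⟨g, hg, fun y hy => congrFun hgc ⟨y, hy⟩⟩

/-! ### Translation of the initial value -/

section Translation

/-- The path `z` translated by the constant `c`. -/
def translate (c : ℝ) (z : C(ℝ, ℝ)) : C(ℝ, ℝ) := ContinuousMap.const ℝ c + z

@[simp] lemma translate_apply (c : ℝ) (z : C(ℝ, ℝ)) (s : ℝ) : translate c z s = c + z s := rfl

lemma measurable_translate {α : Type*} [MeasurableSpace α] {f : α → ℝ} {g : α → C(ℝ, ℝ)}
    (hf : Measurable f) (hg : Measurable g) : Measurable fun x => translate (f x) (g x) :=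
  measurable_path fun s => hf.add ((measurable_eval s).comp hg)

lemma timeShift_translate (u c : ℝ) (z : C(ℝ, ℝ)) :
    timeShift u (translate c z) = translate c (timeShift u z) := rfl

lemma translate_translate (c d : ℝ) (z : C(ℝ, ℝ)) :
    translate c (translate d z) = translate (c + d) z :=
  ContinuousMap.ext fun s => by simp [add_assoc]

/-- The density of a law on path space under a time shift by `-t`. -/
noncomputable def shiftDensity (m : ℝ → ℝ) (t : ℝ) (x : C(ℝ, ℝ)) : ℝ≥0∞ :=
  ENNReal.ofReal (m (x t) / m (x 0))

lemma measurable_shiftDensity {m : ℝ → ℝ} (hm : Measurable m) (t : ℝ) :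
    Measurable (shiftDensity m t) :=
  ((hm.comp (measurable_eval t)).div (hm.comp (measurable_eval 0))).ennreal_ofReal

/-- If the increments of a random path have a law for which the time shift acts measure-preservingly
through `σ`, and the initial value is independent with density `m`, then the time shift acts on the
law of the path with density `m (x t) / m (x 0)`. -/
lemma map_timeShift_eq_withDensity {N : Measure C(ℝ, ℝ)} [SFinite N] {Z σ : C(ℝ, ℝ) → C(ℝ, ℝ)}
    (hZ : Measurable Z) (hσ : Measurable σ) (hN : N.map σ = N) (hZ0 : ∀ w, Z w 0 = 0) {t : ℝ}
    (hshift : ∀ᵐ w ∂N, timeShift (-t) (Z w) = translate (Z w (-t)) (Z (σ w)))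
    {m : ℝ → ℝ} (hm : Measurable m) (hm0 : ∀ x, 0 < m x) {P : Measure C(ℝ, ℝ)}
    (hP : P = (((volume : Measure ℝ).withDensity fun x => ENNReal.ofReal (m x)).prod N).map
      fun p => translate p.1 (Z p.2)) :
    P.map (timeShift (-t)) = P.withDensity (shiftDensity m t) := by
  have hJ : Measurable fun p : ℝ × C(ℝ, ℝ) => translate p.1 (Z p.2) :=
    measurable_translate measurable_fst (hZ.comp measurable_snd)
  have hPint : ∀ f : C(ℝ, ℝ) → ℝ≥0∞, Measurable f → ∫⁻ x, f x ∂P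
      = ∫⁻ w, ∫⁻ c, ENNReal.ofReal (m c) * f (translate c (Z w)) ∂volume ∂N := by
    intro f hf
    have hfJ : Measurable fun p : ℝ × C(ℝ, ℝ) => f (translate p.1 (Z p.2)) := hf.comp hJ
    rw [hP, lintegral_map hf hJ, lintegral_prod_symm _ hfJ.aemeasurable]
    refine lintegral_congr fun w => ?_
    rw [lintegral_withDensity_eq_lintegral_mul _ hm.ennreal_ofReal]
    · rfl
    · exact hf.comp (measurable_translate (g := fun _ => Z w) measurable_id measurable_const)
  refine Measure.ext_of_lintegral _ fun f hf => ?_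
  -- Both integrals reduce to `∫ H dN`: the left one by translating `c` and using that `σ` preserves
  -- `N`, the right one because `m c` cancels the denominator of the density.
  set H : C(ℝ, ℝ) → ℝ≥0∞ := fun w =>
    ∫⁻ c, ENNReal.ofReal (m (c + Z w t)) * f (translate c (Z w)) ∂volume with hH
  have hHm : Measurable H := by
    refine Measurable.lintegral_prod_right' (f := fun p : C(ℝ, ℝ) × ℝ =>
      ENNReal.ofReal (m (p.2 + Z p.1 t)) * f (translate p.2 (Z p.1))) ?_
    have h1 : Measurable fun p : C(ℝ, ℝ) × ℝ => p.2 + Z p.1 t :=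
      measurable_snd.add ((measurable_eval t).comp (hZ.comp measurable_fst))
    exact (hm.comp h1).ennreal_ofReal.mul
      (hf.comp (measurable_translate measurable_snd (hZ.comp measurable_fst)))
  have hleft : ∫⁻ x, f x ∂(P.map (timeShift (-t))) = ∫⁻ w, H w ∂N := by
    have hfs : Measurable fun x => f (timeShift (-t) x) := hf.comp (measurable_timeShift _)
    rw [lintegral_map hf (measurable_timeShift _), hPint _ hfs]
    have hcomp : ∫⁻ w, H w ∂N = ∫⁻ w, H (σ w) ∂N := by
      conv_lhs => rw [← hN]
      exact lintegral_map hHm hσ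
    rw [hcomp]
    refine lintegral_congr_ae ?_
    filter_upwards [hshift] with w hw
    -- At time `t` the shifted path takes its old initial value, and `Z w 0 = 0`. Thus the old `c`
    -- is recovered as the new initial value plus `Z (σ w) t`.
    have ht : Z w (-t) + Z (σ w) t = 0 := by
      have := DFunLike.congr_fun hw t
      rw [translate_apply] at this
      rw [← this, ← hZ0 w]
      simp [timeShift]
    refine Eq.trans ?_ (lintegral_add_right_eq_self
      (fun c => ENNReal.ofReal (m (c + Z (σ w) t)) * f (translate c (Z (σ w)))) (Z w (-t)))
    refine lintegral_congr fun c => ?_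
    rw [timeShift_translate, hw, translate_translate, add_assoc c, ht, add_zero]
  rw [hleft, lintegral_withDensity_eq_lintegral_mul _ (measurable_shiftDensity hm t) hf,
    hPint _ ((measurable_shiftDensity hm t).mul hf)]
  refine lintegral_congr fun w => lintegral_congr fun c => ?_
  rw [Pi.mul_apply, ← mul_assoc, shiftDensity, ← ENNReal.ofReal_mul (hm0 c).le, translate_apply,
    translate_apply, hZ0, add_zero, mul_div_cancel₀ _ (hm0 c).ne']

end Translation

/-! ### The process with delay -/

lemma delayOU_apply {a : ℝ} (ha : -1 < a) (ha0 : a < 0) {W : C(ℝ, ℝ)} (hW : LeftGrowth W) (s : ℝ) :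
    delayOU a W s = delayPath a W s := by
  have hc : Continuous (delayPath a W) :=
    (continuous_baseProcess ha ha0 hW).sub continuous_const
  rw [delayOU, toPath, dif_pos hc, ContinuousMap.coe_mk]

lemma delayPath_zero (a : ℝ) (W : C(ℝ, ℝ)) : delayPath a W 0 = W 0 := by
  rw [delayPath, b0, sub_sub_cancel]

lemma solvesDelay_delayOU {a : ℝ} (ha : -1 < a) (ha0 : a < 0) {W : C(ℝ, ℝ)} (hW : LeftGrowth W) :
    SolvesDelay a (b0 a W) W (delayOU a W) := by
  intro u s
  simp_rw [delayOU_apply ha ha0 hW, delayPath, sub_add_cancel]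
  rw [sub_sub_sub_cancel_right, baseProcess_sub ha ha0 hW u s, intervalIntegral.integral_const_mul]

/-- The identity also holds for paths `W` with a discontinuous trajectory, since the default path
`0` is invariant under reversal. -/
lemma anticipationOU_eq (a : ℝ) (W : C(ℝ, ℝ)) :
    anticipationOU a W = timeReverse (delayOU a (timeReverse W)) := by
  rw [anticipationOU, delayOU, toPath, toPath]
  by_cases h : Continuous (delayPath a (timeReverse W))
  · have h' : Continuous (anticipationPath a W) := h.comp continuous_neg
    rw [dif_pos h, dif_pos h']
    rfl
  · have h' : ¬ Continuous (anticipationPath a W) := fun hc => h (by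
      have := hc.comp continuous_neg
      simpa [anticipationPath, Function.comp_def] using this)
    rw [dif_neg h, dif_neg h']
    rfl

lemma solvesAnticipation_timeReverse {a b : ℝ} {W x : C(ℝ, ℝ)}
    (h : SolvesDelay a b (timeReverse W) x) : SolvesAnticipation a b W (timeReverse x) := by
  intro u s
  have h1 := h (-u) (-s)
  have hW : ∀ v, timeReverse W v = W (-v) := fun v => rfl
  have hx : ∀ v, timeReverse x v = x (-v) := fun v => rfl
  rw [hW, hW, neg_neg, neg_neg] at h1
  rw [hx, hx, h1, ← intervalIntegral.integral_comp_neg, intervalIntegral.integral_symm,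
    ← intervalIntegral.integral_neg]
  congr 1
  refine intervalIntegral.integral_congr fun v _ => ?_
  simp only [hx]
  rw [show -v - 1 = -(v + 1) by ring]
  ring

/-- `Z w` is the solution driven by `w`, recentred to vanish at `0`. A time-shifted solution is
driven by the shifted path and still grows linearly, so uniqueness identifies it with the solution
built from that path; recentring leaves the constant `Z w u`. -/
lemma exists_delayOU_eq {a : ℝ} (ha : -1 < a) (ha0 : a < 0) :
    ∃ Z : C(ℝ, ℝ) → C(ℝ, ℝ), Measurable Z ∧ (∀ w, Z w 0 = 0) ∧
      (∀ W : C(ℝ, ℝ), LeftGrowth W → delayOU a W = translate (W 0) (Z (incr W))) ∧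
      ∀ w : C(ℝ, ℝ), LeftGrowth w → w 0 = 0 → ∀ u : ℝ,
        timeShift u (Z w) = translate (Z w u) (Z (incr (timeShift u w))) := by
  obtain ⟨g, hg, hgd⟩ := exists_measurable_solution ha ha0
  have hsol : ∀ W : C(ℝ, ℝ), LeftGrowth W → ∃ y : C(ℝ, ℝ), (∀ s, y s = baseProcess a W s) ∧
      LeftGrowth y ∧ (∀ u s, y s - y u = a * (∫ v in u..s, y (v - 1)) + (W s - W u)) ∧
      g (incr W) = y := by
    intro W hW
    refine ⟨⟨baseProcess a W, continuous_baseProcess ha ha0 hW⟩, fun s => rfl,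
      leftGrowth_baseProcess ha ha0 hW, baseProcess_sub ha ha0 hW, ?_⟩
    have hd : driving a ⟨baseProcess a W, continuous_baseProcess ha ha0 hW⟩ = incr W := by
      ext s
      have := baseProcess_sub ha ha0 hW 0 s
      rw [driving_apply, incr_apply, ContinuousMap.coe_mk]
      linarith
    rw [← hd]
    exact hgd _ (leftGrowth_baseProcess ha ha0 hW)
  have hincr : ∀ w : C(ℝ, ℝ), w 0 = 0 → incr w = w := fun w hw => by
    ext s
    rw [incr_apply, hw, sub_zero]
  refine ⟨fun w => incr (g w), measurable_incr.comp hg, fun w => by simp, fun W hW => ?_,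
    fun w hw hw0 u => ?_⟩
  · obtain ⟨y, hy, -, -, hgy⟩ := hsol W hW
    ext s
    rw [delayOU_apply ha ha0 hW, delayPath, b0, translate_apply]
    dsimp only
    rw [hgy, incr_apply, hy, hy]
    ring
  · have hw' : LeftGrowth (timeShift u w) := hw.comp_add w.continuous u
    obtain ⟨y, -, gy, ey, hgy⟩ := hsol w hw
    obtain ⟨y', -, gy', ey', hgy'⟩ := hsol (timeShift u w) hw'
    rw [hincr w hw0] at hgy
    have hyy : (timeShift u y : ℝ → ℝ) = y' := by
      refine eq_of_delay ha ha0 (timeShift u y).continuous y'.continuous (w₁ := timeShift u w)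
        (fun p s => ?_) ey' (gy.comp_add y.continuous u) gy' fun _ _ => rfl
      have h1 := ey (p + u) (s + u)
      rw [← intervalIntegral.integral_comp_add_right] at h1
      have h2 : ∀ v, timeShift u y v = y (v + u) := fun v => rfl
      have h3 : ∀ v, timeShift u w v = w (v + u) := fun v => rfl
      simp_rw [h2, h3, h1, add_sub_right_comm]
    ext s
    have h0 := congrFun hyy 0
    have hs := congrFun hyy s
    simp only [timeShift, ContinuousMap.comp_apply, ContinuousMap.coe_mk, zero_add] at h0 hs
    rw [translate_apply]
    dsimp only
    rw [hgy, hgy', incr_apply, incr_apply, ← h0, ← hs]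
    simp only [timeShift, ContinuousMap.comp_apply, ContinuousMap.coe_mk, incr_apply]
    ring

lemma aemeasurable_and_map_delayOU {a : ℝ} (ha : -1 < a) (ha0 : a < 0) {m : ℝ → ℝ}
    (hm : Measurable m) (hm0 : ∀ x, 0 < m x) {Q : Measure C(ℝ, ℝ)} [IsProbabilityMeasure Q]
    (hQ : IsTwoSidedBrownian ((volume : Measure ℝ).withDensity fun x => ENNReal.ofReal (m x)) Q) :
    AEMeasurable (delayOU a) Q ∧ ∀ t, (Q.map (delayOU a)).map (timeShift (-t))
      = (Q.map (delayOU a)).withDensity (shiftDensity m t) := by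
  obtain ⟨Z, hZ, hZ0, hX, hshift⟩ := exists_delayOU_eq ha ha0
  have hgrow := hQ.ae_leftGrowth
  have hmeas : Measurable fun W : C(ℝ, ℝ) => translate (W 0) (Z (incr W)) :=
    measurable_translate (measurable_eval 0) (hZ.comp measurable_incr)
  have hae : delayOU a =ᵐ[Q] fun W => translate (W 0) (Z (incr W)) := by
    filter_upwards [hgrow] with W hW using hX W hW
  refine ⟨⟨_, hmeas, hae⟩, fun t => ?_⟩
  have hN : IsProbabilityMeasure (Q.map incr) :=
    Measure.isProbabilityMeasure_map measurable_incr.aemeasurable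
  have hσ : Measurable fun w => incr (timeShift (-t) w) :=
    measurable_incr.comp (measurable_timeShift _)
  refine map_timeShift_eq_withDensity hZ hσ (hQ.map_incr_timeShift (-t)) hZ0 ?_ hm hm0 ?_
  · have hgrow' : ∀ᵐ w ∂(Q.map incr), LeftGrowth (w : C(ℝ, ℝ)) ∧ w 0 = 0 := by
      have hset : MeasurableSet {w : C(ℝ, ℝ) | LeftGrowth w ∧ w 0 = 0} :=
        measurableSet_leftGrowth.inter (measurableSet_eq_fun (measurable_eval 0) measurable_const)
      refine (ae_map_iff measurable_incr.aemeasurable hset).2 ?_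
      filter_upwards [hgrow] with W hW
      exact ⟨hW.sub (leftGrowth_const (W 0)), by simp⟩
    filter_upwards [hgrow'] with w hw using hshift w hw.1 hw.2 (-t)
  · have hprod := (indepFun_iff_map_prod_eq_prod_map_map (measurable_eval 0).aemeasurable
      measurable_incr.aemeasurable).1 hQ.indepFun_incr
    rw [hQ.initial] at hprod
    have hJ : Measurable fun p : ℝ × C(ℝ, ℝ) => translate p.1 (Z p.2) :=
      measurable_translate measurable_fst (hZ.comp measurable_snd)
    rw [Measure.map_congr hae, ← hprod, Measure.map_map hJ
      ((measurable_eval 0).prodMk measurable_incr)]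
    rfl

/-! ### The process with anticipation -/

lemma map_withDensity_comp {α β : Type*} [MeasurableSpace α] [MeasurableSpace β] {μ : Measure α}
    {g : α → β} (hg : Measurable g) {f : β → ℝ≥0∞} (hf : Measurable f) :
    (μ.withDensity fun x => f (g x)).map g = (μ.map g).withDensity f := by
  ext s hs
  rw [Measure.map_apply hg hs, withDensity_apply _ (hg hs), withDensity_apply _ hs,
    setLIntegral_map hs hf hg]

lemma timeReverse_timeShift (u : ℝ) (x : C(ℝ, ℝ)) :
    timeShift u (timeReverse x) = timeReverse (timeShift (-u) x) := by
  ext s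
  simp only [timeShift, timeReverse, ContinuousMap.comp_apply, ContinuousMap.coe_mk]
  congr 1
  ring

/-- Reversal turns a shift by `-t` into a shift by `t`, so the delay result for the reversed
Brownian motion is used at `-t`. -/
lemma aemeasurable_and_map_anticipationOU {a : ℝ} (ha : -1 < a) (ha0 : a < 0) {m : ℝ → ℝ}
    (hm : Measurable m) (hm0 : ∀ x, 0 < m x) {Q : Measure C(ℝ, ℝ)} [IsProbabilityMeasure Q]
    (hQ : IsTwoSidedBrownian ((volume : Measure ℝ).withDensity fun x => ENNReal.ofReal (m x)) Q) :
    AEMeasurable (anticipationOU a) Q ∧ ∀ t, (Q.map (anticipationOU a)).map (timeShift (-t))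
      = (Q.map (anticipationOU a)).withDensity (shiftDensity m t) := by
  have hR := measurable_timeReverse
  have : IsProbabilityMeasure (Q.map timeReverse) :=
    Measure.isProbabilityMeasure_map hR.aemeasurable
  obtain ⟨hX, hmap⟩ := aemeasurable_and_map_delayOU ha ha0 hm hm0 hQ.map_timeReverse
  have heq : anticipationOU a = timeReverse ∘ (delayOU a ∘ timeReverse) :=
    funext fun W => anticipationOU_eq a W
  have hXR : AEMeasurable (delayOU a ∘ timeReverse) Q := hX.comp_measurable hR
  have hlaw : Q.map (anticipationOU a) = ((Q.map timeReverse).map (delayOU a)).map timeReverse := by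
    rw [heq, AEMeasurable.map_map_of_aemeasurable hX hR.aemeasurable,
      AEMeasurable.map_map_of_aemeasurable hR.aemeasurable hXR]
  refine ⟨heq ▸ hR.comp_aemeasurable hXR, fun t => ?_⟩
  rw [hlaw, ← map_withDensity_comp hR (measurable_shiftDensity hm t)]
  have hcomp : timeShift (-t) ∘ timeReverse = timeReverse ∘ timeShift (-(-t)) :=
    funext fun x => timeReverse_timeShift (-t) x
  rw [Measure.map_map (measurable_timeShift _) hR, hcomp,
    ← Measure.map_map hR (measurable_timeShift _), hmap (-t)]
  congr 2
  ext x
  simp [shiftDensity, timeReverse]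

/-- `shiftedMeasure P t` is an image under `timeShift t`, whereas the law of `X_{· - t}` is an image
under `timeShift (-t)`; hence the opposite signs of time in the two densities. -/
lemma rnDeriv_of_map_timeShift {m : ℝ → ℝ} (hm : Measurable m) {Q : Measure C(ℝ, ℝ)}
    [IsProbabilityMeasure Q] {X : C(ℝ, ℝ) → C(ℝ, ℝ)} (hX : AEMeasurable X Q)
    (h : ∀ t, (Q.map X).map (timeShift (-t)) = (Q.map X).withDensity (shiftDensity m t)) (t : ℝ) :
    (shiftedMeasure (Q.map X) t ≪ Q.map X ∧
      (shiftedMeasure (Q.map X) t).rnDeriv (Q.map X)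
        =ᵐ[Q.map X] fun x => ENNReal.ofReal (m (x (-t)) / m (x 0))) ∧
    (Q.map (fun W => timeShift (-t) (X W)) ≪ Q.map X ∧
      (Q.map (fun W => timeShift (-t) (X W))).rnDeriv (Q.map X)
        =ᵐ[Q.map X] fun x => ENNReal.ofReal (m (x t) / m (x 0))) := by
  have h1 : shiftedMeasure (Q.map X) t = (Q.map X).withDensity (shiftDensity m (-t)) := by
    rw [← h (-t), neg_neg, shiftedMeasure]
  have h2 : Q.map (fun W => timeShift (-t) (X W)) = (Q.map X).withDensity (shiftDensity m t) := by
    rw [← h t, AEMeasurable.map_map_of_aemeasurable (measurable_timeShift _).aemeasurable hX]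
    rfl
  rw [h1, h2]
  exact ⟨⟨withDensity_absolutelyContinuous _ _,
      Measure.rnDeriv_withDensity _ (measurable_shiftDensity hm _)⟩,
    withDensity_absolutelyContinuous _ _,
      Measure.rnDeriv_withDensity _ (measurable_shiftDensity hm _)⟩

end DelayOU

theorem theorem3p3 (a : ℝ) (ha : -1 < a) (ha0 : a < 0)
    (m : ℝ → ℝ) (hm : ContDiff ℝ 1 m) (hm0 : ∀ x, 0 < m x)
    (Q : Measure C(ℝ, ℝ)) [IsProbabilityMeasure Q]
    (hQ : DelayOU.IsTwoSidedBrownian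
      ((volume : Measure ℝ).withDensity (fun x => ENNReal.ofReal (m x))) Q) :
    (∀ᵐ W ∂Q, (∀ s, DelayOU.delayOU a W s = DelayOU.delayPath a W s) ∧
      DelayOU.delayOU a W 0 = W 0 ∧
      DelayOU.SolvesDelay a (DelayOU.b0 a W) W (DelayOU.delayOU a W)) ∧
    (∀ᵐ W ∂Q, (∀ s, DelayOU.anticipationOU a W s = DelayOU.anticipationPath a W s) ∧
      DelayOU.anticipationOU a W 0 = W 0 ∧
      DelayOU.SolvesAnticipation a (DelayOU.b0 a (DelayOU.timeReverse W)) W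
        (DelayOU.anticipationOU a W)) ∧
    ∀ X : C(ℝ, ℝ) → C(ℝ, ℝ), (X = DelayOU.delayOU a ∨ X = DelayOU.anticipationOU a) →
      AEMeasurable X Q ∧
      ∀ t : ℝ,
        (DelayOU.shiftedMeasure (Q.map X) t ≪ Q.map X ∧
          (DelayOU.shiftedMeasure (Q.map X) t).rnDeriv (Q.map X)
            =ᵐ[Q.map X] fun x => ENNReal.ofReal (m (x (-t)) / m (x 0))) ∧
        (Q.map (fun W => DelayOU.timeShift (-t) (X W)) ≪ Q.map X ∧
          (Q.map (fun W => DelayOU.timeShift (-t) (X W))).rnDeriv (Q.map X)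
            =ᵐ[Q.map X] fun x => ENNReal.ofReal (m (x t) / m (x 0))) := by
  have hmm : Measurable m := hm.continuous.measurable
  have hR := DelayOU.measurable_timeReverse
  have : IsProbabilityMeasure (Q.map DelayOU.timeReverse) :=
    Measure.isProbabilityMeasure_map hR.aemeasurable
  have hgrowR : ∀ᵐ W ∂Q, DelayOU.LeftGrowth (DelayOU.timeReverse W) :=
    ae_of_ae_map hR.aemeasurable hQ.map_timeReverse.ae_leftGrowth
  refine ⟨?_, ?_, ?_⟩
  · filter_upwards [hQ.ae_leftGrowth] with W hW
    have hv := DelayOU.delayOU_apply ha ha0 hW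
    exact ⟨hv, (hv 0).trans (DelayOU.delayPath_zero a W),
      DelayOU.solvesDelay_delayOU ha ha0 hW⟩
  · filter_upwards [hgrowR] with W hW
    have hv : ∀ s, DelayOU.anticipationOU a W s = DelayOU.anticipationPath a W s := fun s => by
      rw [DelayOU.anticipationOU_eq]
      exact DelayOU.delayOU_apply ha ha0 hW (-s)
    refine ⟨hv, ?_, ?_⟩
    · rw [hv, DelayOU.anticipationPath, neg_zero, DelayOU.delayPath_zero]
      simp [DelayOU.timeReverse]
    · rw [DelayOU.anticipationOU_eq]
      exact DelayOU.solvesAnticipation_timeReverse (DelayOU.solvesDelay_delayOU ha ha0 hW)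
  · rintro X (rfl | rfl)
    · obtain ⟨hX, h⟩ := DelayOU.aemeasurable_and_map_delayOU ha ha0 hmm hm0 hQ
      exact ⟨hX, DelayOU.rnDeriv_of_map_timeShift hmm hX h⟩
    · obtain ⟨hX, h⟩ := DelayOU.aemeasurable_and_map_anticipationOU ha ha0 hmm hm0 hQ
      exact ⟨hX, DelayOU.rnDeriv_of_map_timeShift hmm hX h⟩
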